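/- For a finite set $I$ with $|I|=N$, a vector $\eta\in[0,\infty)^I$ and a symmetric matrix $W\in\mathbb R^{I\times I}$ with non-negative entries, and for $\beta\in(0,\infty)^I$, let $H_\beta$ be the matrix with entries $H_\beta(i,i)=2\beta_i-W(i,i)$ and $H_\beta(i,j)=-W(i,j)$ for $i\neq j$. Let $\nu_N^{W,\eta}$ be the probability measure on $(0,\infty)^I$ $$\nu_N^{W,\eta}(d\beta)=\Big(\frac2\pi\Big)^{N/2}\exp\Big(-\tfrac12\Big(\mathbf 1^{T}H_\beta\mathbf 1+\eta^{T}H_\beta^{-1}\eta-2\sum_{i\in I}\eta_i\Big)\Big)\frac{1}{\sqrt{\det H_\beta}}\,1_{\{H_\beta\text{ positive definite}\}}\,d\beta ,$$ and let $\tilde\nu_N^{W,\eta}$ be the law of $H_\beta$ when $\beta$ has law $\nu_N^{W,\eta}$. Two indices $i,j$ are called $H$-connected if there is a finite sequence $i=k_1,\dots,k_m=j$ with $H(k_a,k_{a+1})\ne0$ for all $1\le a\le m-1$. **Theorem 5.** Let $n\ge0$ be an integer, let $W\in M_n(\mathbb R)$ be symmetric with zero diagonal and non-negative off-diagonal entries,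 let $W^1,W^2\in[0,\infty)^n$ be column vectors and $W^3:=W^1+W^2$, and let $0\le w^-<w^+$. Put $$W^{\pm}:=\begin{pmatrix}W&W^1&W^2\\ (W^1)^T&0&w^\pm\\ (W^2)^T&w^\pm&0\end{pmatrix},\qquad W^\infty:=\begin{pmatrix}W&W^3\\ (W^3)^T&0\end{pmatrix}$$ (for $n=0$ only the lower right blocks remain). For $X\in\mathbb R^{n+2}$ let $\overline X\in\mathbb R^{n+1}$ be given by $\overline X_i=X_i$ for $1\le i\le n$ and $\overline X_{n+1}=X_{n+1}+X_{n+2}$. For every $X^1\in[0,\infty)^{n+2}$ there exist random matrices $H^-,H^+,H^\infty$, defined on one probability space, with laws $\tilde\nu_{n+2}^{W^-,0}$, $\tilde\nu_{n+2}^{W^+,0}$, $\tilde\nu_{n+1}^{W^\infty,0}$ respectively and with inverses $G^-,G^+,G^\infty$ (which exist almost surely), such that 1. $(X^1)^TG^-X^1=(X^1)^TG^+X^1=\overline{X^1}^{\,T}G^\infty\,\overline{X^1}$ almost surely; 2. $H^-(i,i)=H^+(i,i)=H^\infty(i,i)$ for all $1\le i\le n$; 3. for every $X^2\in[0,\infty)^{n+2}$,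 almost surely, $$E\big((X^1)^TG^+X^2\,\big|\,H^\infty\big)=\overline{X^1}^{\,T}G^\infty\,\overline{X^2},$$ and, if $n+1$ and $n+2$ are $H^-$-connected (almost surely), $$E\big((X^1)^TG^-X^2\,\big|\,H^+\big)=(X^1)^TG^+X^2 .$$ The bilinear forms in 3 are almost surely non-negative but need not be integrable; the conditional expectations are those of non-negative random variables, given the $\sigma$-algebras generated by $H^\infty$ and by $H^+$ respectively. -/

import Mathlib

open MeasureTheory
open scoped Matrix

/-- Matrices carry the product (Borel) σ-algebra of their entries. -/
instance matrixMeasurableSpace {ι κ : Type*} : MeasurableSpace (Matrix ι κ ℝ) :=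
  inferInstanceAs (MeasurableSpace (ι → κ → ℝ))

section BetaField

variable {ι : Type*} [Fintype ι] [DecidableEq ι]

/-- The matrix `H_β`, with entries `2 β_i - W(i,i)` on the diagonal and `-W(i,j)` off it. -/
def betaMatrix (W : Matrix ι ι ℝ) (β : ι → ℝ) : Matrix ι ι ℝ :=
  Matrix.diagonal (fun i => 2 * β i) - W

open Classical in
/-- The density of `ν^{W,η}` with respect to Lebesgue measure. The factor `(2/π)^{|ι|/2}` is the
normalising constant that makes the β-field law a probability measure. -/
noncomputable def betaDensity (W : Matrix ι ι ℝ) (η β : ι → ℝ) : ℝ :=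
  if (∀ i, 0 < β i) ∧ (betaMatrix W β).PosDef then
    (√(2 / Real.pi)) ^ Fintype.card ι *
      Real.exp (-(1 / 2) * ((1 : ι → ℝ) ⬝ᵥ (betaMatrix W β *ᵥ 1)
        + η ⬝ᵥ ((betaMatrix W β)⁻¹ *ᵥ η) - 2 * ∑ i, η i)) /
      √(betaMatrix W β).det
  else 0

/-- The law `ν^{W,η}` of the β-field. -/
noncomputable def betaLaw (W : Matrix ι ι ℝ) (η : ι → ℝ) : Measure (ι → ℝ) :=
  volume.withDensity (fun β => ENNReal.ofReal (betaDensity W η β))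

/-- The law `ν̃^{W,η}` of the random matrix `H_β` when `β` has law `ν^{W,η}`. -/
noncomputable def betaMatrixLaw (W : Matrix ι ι ℝ) (η : ι → ℝ) : Measure (Matrix ι ι ℝ) :=
  (betaLaw W η).map (betaMatrix W)

end BetaField

/-- `i` and `j` are `H`-connected: there is a finite sequence `i = k_1, …, k_m = j` with
`H(k_a, k_{a+1}) ≠ 0` for all `a < m`. -/
def MatrixConnected {ι : Type*} (H : Matrix ι ι ℝ) (i j : ι) : Prop :=
  Relation.ReflTransGen (fun k l => H k l ≠ 0) i j

/-- The weight matrix `(W, W¹, W²; W¹ᵀ, 0, w; W²ᵀ, w, 0)`. Vertices `1, …, n` are `Sum.inl i`,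
vertices `n+1` and `n+2` are `Sum.inr 0` and `Sum.inr 1`. -/
def twoPointWeights {n : ℕ} (W : Matrix (Fin n) (Fin n) ℝ) (W₁ W₂ : Fin n → ℝ) (w : ℝ) :
    Matrix (Fin n ⊕ Fin 2) (Fin n ⊕ Fin 2) ℝ :=
  Matrix.fromBlocks W (Matrix.of fun i => ![W₁ i, W₂ i])
    (Matrix.of ![W₁, W₂]) !![0, w; w, 0]

/-- The weight matrix `(W, W³; W³ᵀ, 0)` with `W³ = W¹ + W²`, in which vertices `n+1` and `n+2`
are merged into the single vertex `Sum.inr 0`. -/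
def mergedWeights {n : ℕ} (W : Matrix (Fin n) (Fin n) ℝ) (W₁ W₂ : Fin n → ℝ) :
    Matrix (Fin n ⊕ Fin 1) (Fin n ⊕ Fin 1) ℝ :=
  Matrix.fromBlocks W (Matrix.of fun i => ![W₁ i + W₂ i])
    (Matrix.of ![W₁ + W₂]) !![0]

/-- The vector `X̄`, obtained from `X` by adding up the last two coordinates. -/
def mergeVec {n : ℕ} (X : Fin n ⊕ Fin 2 → ℝ) : Fin n ⊕ Fin 1 → ℝ :=
  Sum.elim (fun i => X (Sum.inl i)) (fun _ => X (Sum.inr 0) + X (Sum.inr 1))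

/-- The bilinear form `Xᵀ H⁻¹ Y`. -/
noncomputable def greenForm {ι : Type*} [Fintype ι] [DecidableEq ι] (H : Matrix ι ι ℝ)
    (X Y : ι → ℝ) : ℝ :=
  X ⬝ᵥ (H⁻¹ *ᵥ Y)

/-- `E(Y | T) = Z` for almost surely non-negative real random variables `Y`, `Z` and a random
element `T`. The conditional expectation is the one of `[0, ∞]`-valued random variables, given the
σ-algebra generated by `T`: `Y` is not required to be integrable. -/
def CondExpNonnegEq {Ω α : Type*} [MeasurableSpace Ω] [MeasurableSpace α] (P : Measure Ω)
    (Y : Ω → ℝ) (T : Ω → α) (Z : Ω → ℝ) : Prop :=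
  (∀ᵐ ω ∂P, 0 ≤ Y ω) ∧ (∀ᵐ ω ∂P, 0 ≤ Z ω) ∧
    condLExp (MeasurableSpace.comap T inferInstance) P (fun ω => ENNReal.ofReal (Y ω))
      =ᵐ[P] fun ω => ENNReal.ofReal (Z ω)

/-!
The vertices `n + 1` and `n + 2` are studied after eliminating the first `n` vertices. The density
of a β-field factorises under block elimination (`betaDensity_fromBlocks`): the field on the first
`n` vertices is again a β-field, with `η = W₁ + W₂` for all three matrices of the theorem, and it
can therefore be shared by them. Given it, the Schur complement is a β-field with `η = 0` on two
vertices, with off-diagonal weight `c = w + W₁ᵀ A⁻¹ W₂` (`crossWeight`), where `A` is the block of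
the first `n` vertices, or on the single merged vertex. The normalisation of the β-field (`isProbabilityMeasure_betaLaw`) follows from the same
factorisation by eliminating one vertex at a time.

Let `x` be the vector on the last two vertices which block elimination makes of `X₁`, and let `x̂`
be the multiple of `x` with `x̂₀ + x̂₁ = 1`, written as `((1 - δ)/2, (1 + δ)/2)`; if `x = 0`, any
such direction with non-negative entries will do. A positive definite matrix `S` on two vertices
with off-diagonal entry `-c` is uniquely of the form
`S = m² x̂ x̂ᵀ + z zᵀ` with `m > 0` and `z = (z₁, -z₂)`, `z₁, z₂ ≥ 0`. In the coordinates `m` and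
`N = z₁ - z₂` one has `1ᵀ S 1 = m² + N²`, and with `D = z₁ + z₂`, a function of `c`, `δ`, `m` and
`|N|`, the Jacobian divided by `√det S` is proportional to the tilt `(D + δ N) / D`. Hence `m` and
`N` are standard Gaussians tilted by this factor (`lintegral_betaDensity_fin_two`); on the merged
vertex the Schur complement is `m²` with `m` Gaussian and no tilt. As `D` is even in `N`, the tilt
is `1` on average over the sign of `N`, so `m` has the same law in all three cases and can be shared
as well. Since `S⁻¹ x̂ = m⁻² (z₂, z₁) / (x̂₀ z₂ + x̂₁ z₁)`, the form `x̂ᵀ S⁻¹ x̂ = m⁻²` depends on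
`m` alone, which makes the quadratic forms at `X₁` agree. Moreover

  tilt · `x̂ᵀ S⁻¹ y` = `m⁻² ((y₀ + y₁) + (N / D) (y₁ - y₀))`.

Averaging over the sign of `N` leaves `m⁻² (y₀ + y₁)`, which is the Green form of the merged vertex:
this is the conditional expectation given `H^∞`. For weights `w⁻ < w⁺`, with corresponding
`D⁻ ≤ D⁺`, the coordinate `N` of `H⁻` is that of `H⁺` up to a sign. The joint density of `N` and of
this sign is the tilt of `H⁻` times `(1 ± D⁻ / D⁺) / 2` (`jointWeight`). Its second marginal is the
tilt of `H⁺`, and as `(N / D⁻) (D⁻ / D⁺) = N / D⁺`, the Green form of `H⁺` is the conditional mean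
of that of `H⁻` (`jointWeight_pairGreen`).

For `H⁻` the identity displayed above is used at every `N`, where `D + δ N` must not vanish. This
holds if `c > 0`, and connectedness of the last two vertices is what ensures it
(`crossWeight_pos`). For `H⁺` it is ensured by `w⁺ > 0`.
-/

set_option linter.unusedSectionVars false

open scoped ENNReal

/-! ### The Green form and inverses of M-matrices -/

section GreenForm

variable {ι : Type*} [Fintype ι] [DecidableEq ι]

theorem greenForm_add_right (H : Matrix ι ι ℝ) (X Y Z : ι → ℝ) :
    greenForm H X (Y + Z) = greenForm H X Y + greenForm H X Z := by
  simp [greenForm, Matrix.mulVec_add, dotProduct_add]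

theorem greenForm_add_left (H : Matrix ι ι ℝ) (X Y Z : ι → ℝ) :
    greenForm H (X + Y) Z = greenForm H X Z + greenForm H Y Z := by
  simp [greenForm, add_dotProduct]

theorem Matrix.PosDef.isUnit_det {H : Matrix ι ι ℝ} (hH : H.PosDef) : IsUnit H.det :=
  (Matrix.isUnit_iff_isUnit_det _).1 hH.isUnit

theorem Matrix.PosDef.mulVec_inv_mulVec {H : Matrix ι ι ℝ} (hH : H.PosDef) (X : ι → ℝ) :
    H *ᵥ (H⁻¹ *ᵥ X) = X := by
  rw [Matrix.mulVec_mulVec, Matrix.mul_nonsing_inv _ hH.isUnit_det, Matrix.one_mulVec]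

theorem Matrix.PosDef.isSymm {H : Matrix ι ι ℝ} (hH : H.PosDef) : H.IsSymm := by
  have := hH.1
  rwa [Matrix.IsHermitian, Matrix.conjTranspose_eq_transpose_of_trivial] at this

theorem greenForm_comm {H : Matrix ι ι ℝ} (hH : H.IsSymm) (X Y : ι → ℝ) :
    greenForm H X Y = greenForm H Y X := by
  have h : (H⁻¹)ᵀ = H⁻¹ := by rw [Matrix.transpose_nonsing_inv, hH]
  rw [greenForm, greenForm, Matrix.dotProduct_mulVec, ← Matrix.mulVec_transpose, h,
    dotProduct_comm]

/-- If `H v = Y`, then the Green form is read off from `v`. -/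
theorem greenForm_eq_dotProduct {H : Matrix ι ι ℝ} (hH : IsUnit H.det) {X Y v : ι → ℝ}
    (hv : H *ᵥ v = Y) : greenForm H X Y = X ⬝ᵥ v := by
  rw [greenForm, ← hv, Matrix.mulVec_mulVec, Matrix.nonsing_inv_mul _ hH, Matrix.one_mulVec]

/-- A positive definite matrix with non-positive off-diagonal entries has an inverse which maps
non-negative vectors to non-negative vectors: test `H v ≥ 0` against the negative part of `v`. -/
theorem Matrix.PosDef.inv_mulVec_nonneg {H : Matrix ι ι ℝ} (hH : H.PosDef)
    (hoff : ∀ i j, i ≠ j → H i j ≤ 0) {Y : ι → ℝ} (hY : ∀ i, 0 ≤ Y i) (i : ι) :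
    0 ≤ (H⁻¹ *ᵥ Y) i := by
  set v := H⁻¹ *ᵥ Y with hvdef
  have hHv : H *ᵥ v = Y := hH.mulVec_inv_mulVec Y
  set m : ι → ℝ := fun i => max (-v i) 0 with hm
  have hterm : ∀ i j, m i * (H i j * v j) ≤ -(m i * (H i j * m j)) := by
    intro i j
    have hmi : 0 ≤ m i := le_max_right _ _
    rcases eq_or_ne i j with rfl | hij
    · rcases le_total 0 (v i) with h | h
      · have : m i = 0 := max_eq_right (by linarith)
        simp [this]
      · have : m i = -v i := max_eq_left (by linarith)
        rw [this]; apply le_of_eq; ring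
    · have h1 : 0 ≤ m j + v j := by
        have : -v j ≤ m j := le_max_left _ _
        linarith
      have h2 := mul_nonneg hmi (mul_nonneg (neg_nonneg.2 (hoff i j hij)) h1)
      nlinarith
  have h1 : m ⬝ᵥ (H *ᵥ v) ≤ -(m ⬝ᵥ (H *ᵥ m)) := by
    simp only [dotProduct, Matrix.mulVec, Finset.mul_sum, ← Finset.sum_neg_distrib]
    exact Finset.sum_le_sum fun i _ => Finset.sum_le_sum fun j _ => hterm i j
  have h2 : 0 ≤ m ⬝ᵥ (H *ᵥ v) := by
    rw [hHv]
    exact Finset.sum_nonneg fun i _ => mul_nonneg (le_max_right _ _) (hY i)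
  have h3 : m = 0 := by
    by_contra hne
    have := hH.dotProduct_mulVec_pos hne
    simp only [star_trivial] at this
    linarith
  have h4 : m i = 0 := congrFun h3 i
  have h5 : -v i ≤ m i := le_max_left _ _
  linarith

theorem greenForm_nonneg {H : Matrix ι ι ℝ} (hH : H.PosDef)
    (hoff : ∀ i j, i ≠ j → H i j ≤ 0) {X Y : ι → ℝ} (hX : ∀ i, 0 ≤ X i) (hY : ∀ i, 0 ≤ Y i) :
    0 ≤ greenForm H X Y :=
  Finset.sum_nonneg fun i _ => mul_nonneg (hX i) (hH.inv_mulVec_nonneg hoff hY i)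

end GreenForm

/-! ### Block elimination -/

section Schur

variable {ι κ : Type*} [Fintype ι] [DecidableEq ι] [Fintype κ] [DecidableEq κ]

theorem det_fromBlocks_schur {A : Matrix ι ι ℝ} (hA : A.PosDef) (B : Matrix ι κ ℝ)
    (D : Matrix κ κ ℝ) :
    (Matrix.fromBlocks A (-B) (-Bᵀ) D).det = A.det * (D - Bᵀ * A⁻¹ * B).det := by
  have := (Matrix.isUnit_iff_isUnit_det _).2 hA.isUnit_det
  let _ := this.invertible
  rw [Matrix.det_fromBlocks₁₁, Matrix.invOf_eq_nonsing_inv]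
  simp [Matrix.neg_mul, Matrix.mul_neg]

theorem posDef_fromBlocks_iff {A : Matrix ι ι ℝ} (hA : A.PosDef) (B : Matrix ι κ ℝ)
    (D : Matrix κ κ ℝ) :
    (Matrix.fromBlocks A (-B) (-Bᵀ) D).PosDef ↔ (D - Bᵀ * A⁻¹ * B).PosDef := by
  have hu := (Matrix.isUnit_iff_isUnit_det _).2 hA.isUnit_det
  let _ := hu.invertible
  have h1 := hA.fromBlocks₁₁ (-B) D
  simp only [Matrix.conjTranspose_eq_transpose_of_trivial, Matrix.transpose_neg, Matrix.neg_mul,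
    Matrix.mul_neg, neg_neg] at h1
  have h2 := det_fromBlocks_schur hA B D
  constructor
  · intro h
    rw [(h1.1 h.posSemidef).posDef_iff_det_ne_zero]
    intro h0
    exact h.det_pos.ne' (by rw [h2, h0, mul_zero])
  · intro h
    rw [(h1.2 h.posSemidef).posDef_iff_det_ne_zero, h2]
    exact (mul_pos hA.det_pos h.det_pos).ne'

theorem Matrix.PosDef.of_fromBlocks {A : Matrix ι ι ℝ} {B : Matrix ι κ ℝ} {C : Matrix κ ι ℝ}
    {D : Matrix κ κ ℝ} (h : (Matrix.fromBlocks A B C D).PosDef) : A.PosDef := by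
  have := h.submatrix (e := Sum.inl) Sum.inl_injective
  rwa [show (Matrix.fromBlocks A B C D).submatrix Sum.inl Sum.inl = A from rfl] at this

/-- Block elimination for the Green form: on the eliminated block it is the Green form of the
block, and on the remaining one that of the Schur complement with shifted arguments. -/
theorem greenForm_fromBlocks {A : Matrix ι ι ℝ} (hA : A.PosDef) (B : Matrix ι κ ℝ)
    {D : Matrix κ κ ℝ} (hS : (D - Bᵀ * A⁻¹ * B).PosDef) (X Y : ι ⊕ κ → ℝ) :
    greenForm (Matrix.fromBlocks A (-B) (-Bᵀ) D) X Y =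
      greenForm A (X ∘ Sum.inl) (Y ∘ Sum.inl) +
      greenForm (D - Bᵀ * A⁻¹ * B)
        (X ∘ Sum.inr + Bᵀ *ᵥ (A⁻¹ *ᵥ (X ∘ Sum.inl)))
        (Y ∘ Sum.inr + Bᵀ *ᵥ (A⁻¹ *ᵥ (Y ∘ Sum.inl))) := by
  set S := D - Bᵀ * A⁻¹ * B with hSdef
  set y := Y ∘ Sum.inr + Bᵀ *ᵥ (A⁻¹ *ᵥ (Y ∘ Sum.inl)) with hy
  have hH : IsUnit (Matrix.fromBlocks A (-B) (-Bᵀ) D).det := by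
    rw [det_fromBlocks_schur hA]
    exact (mul_pos hA.det_pos hS.det_pos).ne'.isUnit
  set r := S⁻¹ *ᵥ y with hr
  have hSr : S *ᵥ r = y := hS.mulVec_inv_mulVec y
  have hv : Matrix.fromBlocks A (-B) (-Bᵀ) D *ᵥ
      (Sum.elim (A⁻¹ *ᵥ (Y ∘ Sum.inl) + A⁻¹ *ᵥ (B *ᵥ r)) r) = Y := by
    rw [Matrix.fromBlocks_mulVec]
    simp only [Sum.elim_comp_inl, Sum.elim_comp_inr, Matrix.mulVec_add, Matrix.neg_mulVec,
      hA.mulVec_inv_mulVec]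
    have h2 : D *ᵥ r = y + Bᵀ *ᵥ (A⁻¹ *ᵥ (B *ᵥ r)) := by
      rw [← hSr, hSdef, Matrix.sub_mulVec]
      simp [Matrix.mulVec_mulVec, Matrix.mul_assoc]
    rw [h2, hy]
    ext k
    rcases k with k | k
    · simp
    · simp only [Sum.elim_inr, Pi.add_apply, Pi.neg_apply, Function.comp_apply]
      ring
  rw [greenForm_eq_dotProduct hH hv]
  have hAs : (A⁻¹)ᵀ = A⁻¹ := by rw [Matrix.transpose_nonsing_inv, hA.isSymm]
  have h3 : (X ∘ Sum.inl) ⬝ᵥ (A⁻¹ *ᵥ (B *ᵥ r)) = (Bᵀ *ᵥ (A⁻¹ *ᵥ (X ∘ Sum.inl))) ⬝ᵥ r := by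
    rw [Matrix.dotProduct_mulVec, ← Matrix.mulVec_transpose, hAs, Matrix.dotProduct_mulVec,
      ← Matrix.mulVec_transpose]
  have h4 : X ⬝ᵥ (Sum.elim (A⁻¹ *ᵥ (Y ∘ Sum.inl) + A⁻¹ *ᵥ (B *ᵥ r)) r) =
      (X ∘ Sum.inl) ⬝ᵥ (A⁻¹ *ᵥ (Y ∘ Sum.inl) + A⁻¹ *ᵥ (B *ᵥ r)) + (X ∘ Sum.inr) ⬝ᵥ r := by
    simp [dotProduct, Fintype.sum_sum_type]
  rw [h4, dotProduct_add, h3, greenForm, greenForm, add_dotProduct, ← hr]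
  ring

end Schur

/-! ### Factorisation of the density of the β-field -/

section BetaDensity

variable {ι κ : Type*} [Fintype ι] [DecidableEq ι] [Fintype κ] [DecidableEq κ]

theorem pos_of_posDef_betaMatrix {W : Matrix ι ι ℝ} (hW : ∀ i, 0 ≤ W i i) {β : ι → ℝ}
    (h : (betaMatrix W β).PosDef) (i : ι) : 0 < β i := by
  have := h.diag_pos (i := i)
  simp [betaMatrix] at this
  linarith [hW i]

/-- The unnormalised logarithm of the density of the β-field, multiplied by `-2`. -/
noncomputable def betaEnergy (W : Matrix ι ι ℝ) (η β : ι → ℝ) : ℝ :=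
  (1 : ι → ℝ) ⬝ᵥ (betaMatrix W β *ᵥ 1) + greenForm (betaMatrix W β) η η - 2 * ∑ i, η i

theorem betaDensity_of_posDef {W : Matrix ι ι ℝ} (hW : ∀ i, 0 ≤ W i i) (η : ι → ℝ) {β : ι → ℝ}
    (h : (betaMatrix W β).PosDef) :
    betaDensity W η β = (√(2 / Real.pi)) ^ Fintype.card ι *
      Real.exp (-(1 / 2) * betaEnergy W η β) / √(betaMatrix W β).det :=
  if_pos ⟨pos_of_posDef_betaMatrix hW h, h⟩

theorem betaDensity_of_not_posDef {W : Matrix ι ι ℝ} (η : ι → ℝ) {β : ι → ℝ}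
    (h : ¬ (betaMatrix W β).PosDef) : betaDensity W η β = 0 :=
  if_neg fun h' => h h'.2

theorem betaDensity_nonneg (W : Matrix ι ι ℝ) (η β : ι → ℝ) : 0 ≤ betaDensity W η β := by
  unfold betaDensity
  split_ifs
  · positivity
  · exact le_rfl

theorem betaMatrix_fromBlocks (W : Matrix ι ι ℝ) (B : Matrix ι κ ℝ) (V : Matrix κ κ ℝ)
    (β : ι → ℝ) (γ : κ → ℝ) :
    betaMatrix (Matrix.fromBlocks W B Bᵀ V) (Sum.elim β γ) =
      Matrix.fromBlocks (betaMatrix W β) (-B) (-Bᵀ) (betaMatrix V γ) := by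
  ext i j
  rcases i with i | i <;> rcases j with j | j <;> simp [betaMatrix, Matrix.diagonal]

/-- The weights of the Schur complement: eliminating the vertices of the first block turns the
weights `V` into `V + Bᵀ A⁻¹ B`, where `A` is the first block of the random matrix. -/
noncomputable def schurWeights (W : Matrix ι ι ℝ) (B : Matrix ι κ ℝ) (V : Matrix κ κ ℝ)
    (β : ι → ℝ) : Matrix κ κ ℝ :=
  V + Bᵀ * (betaMatrix W β)⁻¹ * B

theorem betaMatrix_schurWeights (W : Matrix ι ι ℝ) (B : Matrix ι κ ℝ) (V : Matrix κ κ ℝ)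
    (β : ι → ℝ) (γ : κ → ℝ) :
    betaMatrix (schurWeights W B V β) γ =
      betaMatrix V γ - Bᵀ * (betaMatrix W β)⁻¹ * B := by
  rw [betaMatrix, betaMatrix, schurWeights]; abel

theorem schurWeights_diag_nonneg {W : Matrix ι ι ℝ} (B : Matrix ι κ ℝ) {V : Matrix κ κ ℝ}
    (hV : ∀ k, 0 ≤ V k k) {β : ι → ℝ} (hA : (betaMatrix W β).PosDef) (k : κ) :
    0 ≤ schurWeights W B V β k k := by
  have := (hA.inv.posSemidef.conjTranspose_mul_mul_same B).diag_nonneg (i := k)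
  rw [Matrix.conjTranspose_eq_transpose_of_trivial] at this
  rw [schurWeights, Matrix.add_apply]
  exact add_nonneg (hV k) this

/-- The energy is additive under block elimination, with `η` shifted on both blocks. -/
theorem betaEnergy_fromBlocks {W : Matrix ι ι ℝ} (B : Matrix ι κ ℝ)
    (V : Matrix κ κ ℝ) (ηU : ι → ℝ) (ηV : κ → ℝ) {β : ι → ℝ} {γ : κ → ℝ}
    (hA : (betaMatrix W β).PosDef) (hS : (betaMatrix (schurWeights W B V β) γ).PosDef) :
    betaEnergy (Matrix.fromBlocks W B Bᵀ V) (Sum.elim ηU ηV) (Sum.elim β γ) =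
      betaEnergy W (ηU + B *ᵥ 1) β +
      betaEnergy (schurWeights W B V β) (ηV + Bᵀ *ᵥ ((betaMatrix W β)⁻¹ *ᵥ ηU)) γ := by
  rw [betaMatrix_schurWeights] at hS
  unfold betaEnergy
  rw [betaMatrix_fromBlocks, greenForm_fromBlocks hA B hS, betaMatrix_schurWeights]
  set A := betaMatrix W β
  set D := betaMatrix V γ
  have hone : (1 : ι ⊕ κ → ℝ) = Sum.elim (1 : ι → ℝ) (1 : κ → ℝ) := by
    ext k; rcases k with k | k <;> rfl
  have hAs : (A⁻¹)ᵀ = A⁻¹ := by rw [Matrix.transpose_nonsing_inv, hA.isSymm]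
  have hdot : ∀ (a c : ι → ℝ) (b d : κ → ℝ), Sum.elim a b ⬝ᵥ Sum.elim c d = a ⬝ᵥ c + b ⬝ᵥ d := by
    intro a c b d; simp [dotProduct, Fintype.sum_sum_type]
  have h1 : (1 : ι ⊕ κ → ℝ) ⬝ᵥ (Matrix.fromBlocks A (-B) (-Bᵀ) D *ᵥ 1) =
      1 ⬝ᵥ (A *ᵥ 1) - 2 * (1 ⬝ᵥ (B *ᵥ 1)) + 1 ⬝ᵥ (D *ᵥ 1) := by
    have hB : (1 : κ → ℝ) ⬝ᵥ (Bᵀ *ᵥ 1) = 1 ⬝ᵥ (B *ᵥ 1) := by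
      rw [Matrix.dotProduct_mulVec, Matrix.vecMul_transpose, dotProduct_comm]
    rw [hone, Matrix.fromBlocks_mulVec, hdot]
    simp only [Sum.elim_comp_inl, Sum.elim_comp_inr, Matrix.neg_mulVec, dotProduct_add,
      dotProduct_neg, hB]
    ring
  have h2 : (1 : κ → ℝ) ⬝ᵥ ((D - Bᵀ * A⁻¹ * B) *ᵥ 1) =
      1 ⬝ᵥ (D *ᵥ 1) - greenForm A (B *ᵥ 1) (B *ᵥ 1) := by
    rw [Matrix.sub_mulVec, dotProduct_sub, ← Matrix.mulVec_mulVec, ← Matrix.mulVec_mulVec,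
      Matrix.dotProduct_mulVec 1 Bᵀ, Matrix.vecMul_transpose, greenForm]
  have h3 : ∑ k, (Bᵀ *ᵥ (A⁻¹ *ᵥ ηU)) k = greenForm A ηU (B *ᵥ 1) := by
    rw [greenForm_comm hA.isSymm, greenForm, ← one_dotProduct, Matrix.dotProduct_mulVec 1 Bᵀ,
      Matrix.vecMul_transpose]
  have h4 : (1 : ι → ℝ) ⬝ᵥ (B *ᵥ 1) = ∑ i, (B *ᵥ 1) i := by rw [one_dotProduct]
  rw [h1, h2, greenForm_add_left A ηU, greenForm_add_right A, greenForm_add_right A,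
    greenForm_comm hA.isSymm (B *ᵥ 1) ηU]
  simp only [Sum.elim_comp_inl, Sum.elim_comp_inr, Fintype.sum_sum_type, Sum.elim_inl,
    Sum.elim_inr, Pi.add_apply, Finset.sum_add_distrib, h3, h4]
  ring

/-- Under block elimination the density of the β-field factorises: the first block is a β-field
with `η` increased by the weights leaving the block, and the Schur complement is, conditionally on
the first block, a β-field with weights `schurWeights`. -/
theorem betaDensity_fromBlocks {W : Matrix ι ι ℝ} (hW : ∀ i, 0 ≤ W i i) (B : Matrix ι κ ℝ)
    {V : Matrix κ κ ℝ} (hV : ∀ k, 0 ≤ V k k) (ηU : ι → ℝ) (ηV : κ → ℝ) (β : ι → ℝ) (γ : κ → ℝ) :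
    betaDensity (Matrix.fromBlocks W B Bᵀ V) (Sum.elim ηU ηV) (Sum.elim β γ) =
      betaDensity W (ηU + B *ᵥ 1) β *
      betaDensity (schurWeights W B V β) (ηV + Bᵀ *ᵥ ((betaMatrix W β)⁻¹ *ᵥ ηU)) γ := by
  by_cases hA : (betaMatrix W β).PosDef
  · have hiff := posDef_fromBlocks_iff hA B (betaMatrix V γ)
    rw [← betaMatrix_fromBlocks, ← betaMatrix_schurWeights] at hiff
    by_cases hS : (betaMatrix (schurWeights W B V β) γ).PosDef
    · have hfull : ∀ k, 0 ≤ Matrix.fromBlocks W B Bᵀ V k k := by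
        rintro (k | k)
        · exact hW k
        · exact hV k
      rw [betaDensity_of_posDef hW _ hA,
        betaDensity_of_posDef (schurWeights_diag_nonneg B hV hA) _ hS,
        betaDensity_of_posDef hfull _ (hiff.2 hS), betaEnergy_fromBlocks B V ηU ηV hA hS,
        betaMatrix_fromBlocks, det_fromBlocks_schur hA, ← betaMatrix_schurWeights,
        Real.sqrt_mul hA.det_pos.le, mul_add, Real.exp_add, Fintype.card_sum, pow_add]
      field_simp
    · rw [betaDensity_of_not_posDef _ hS, betaDensity_of_not_posDef _ (fun h => hS (hiff.1 h)),
        mul_zero]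
  · have h : ¬ (betaMatrix (Matrix.fromBlocks W B Bᵀ V) (Sum.elim β γ)).PosDef := by
      rw [betaMatrix_fromBlocks]
      exact fun h => hA h.of_fromBlocks
    rw [betaDensity_of_not_posDef _ h, betaDensity_of_not_posDef _ hA, zero_mul]

end BetaDensity

/-! ### The standard Gaussian measure -/

section Gauss

/-- The standard Gaussian measure on the line. -/
noncomputable abbrev gauss : Measure ℝ := ProbabilityTheory.gaussianReal 0 1

/-- The density of the standard Gaussian measure. -/
noncomputable def gaussDens (x : ℝ) : ℝ := (√(2 * Real.pi))⁻¹ * Real.exp (-(x ^ 2 / 2))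

theorem gaussDens_nonneg (x : ℝ) : 0 ≤ gaussDens x := by unfold gaussDens; positivity

theorem measurable_gaussDens : Measurable gaussDens := by unfold gaussDens; fun_prop

theorem lintegral_gauss (f : ℝ → ℝ≥0∞) :
    ∫⁻ x, f x ∂gauss = ∫⁻ x, ENNReal.ofReal (gaussDens x) * f x := by
  have h : ProbabilityTheory.gaussianPDF 0 1 = fun x => ENNReal.ofReal (gaussDens x) := by
    ext x
    simp [ProbabilityTheory.gaussianPDF, ProbabilityTheory.gaussianPDFReal, gaussDens, neg_div]
  rw [gauss, ProbabilityTheory.gaussianReal_of_var_ne_zero 0 one_ne_zero, h,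
    lintegral_withDensity_eq_lintegral_mul_non_measurable _
      (measurable_gaussDens.ennreal_ofReal) (by simp)]
  rfl

theorem lintegral_gauss_neg {f : ℝ → ℝ≥0∞} (hf : Measurable f) :
    ∫⁻ x, f (-x) ∂gauss = ∫⁻ x, f x ∂gauss := by
  have h : gauss.map (fun x => -x) = gauss := by
    rw [gauss, ProbabilityTheory.gaussianReal_map_neg, neg_zero]
  conv_rhs => rw [← h]
  rw [lintegral_map hf measurable_neg]

theorem ae_gauss_ne_zero : ∀ᵐ x ∂gauss, x ≠ 0 := by
  have := ProbabilityTheory.nullSingletonClass_gaussianReal (μ := 0) (v := 1) one_ne_zero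
  exact Measure.ae_ne _ 0

/-- Two functions with the same even part have the same integral against a Gaussian. -/
theorem lintegral_gauss_congr_even {f k : ℝ → ℝ≥0∞} (hf : Measurable f) (hk : Measurable k)
    (h : ∀ x, x ≠ 0 → f x + f (-x) = k x + k (-x)) :
    ∫⁻ x, f x ∂gauss = ∫⁻ x, k x ∂gauss := by
  have key : ∀ {g : ℝ → ℝ≥0∞}, Measurable g →
      ∫⁻ x, g x + g (-x) ∂gauss = 2 * ∫⁻ x, g x ∂gauss := by
    intro g hg
    rw [lintegral_add_left hg, lintegral_gauss_neg hg, two_mul]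
  have h2 : (2 : ℝ≥0∞) * ∫⁻ x, f x ∂gauss = 2 * ∫⁻ x, k x ∂gauss := by
    rw [← key hf, ← key hk]
    refine lintegral_congr_ae ?_
    filter_upwards [ae_gauss_ne_zero] with x hx using h x hx
  exact (ENNReal.mul_right_inj two_ne_zero ENNReal.ofNat_ne_top).1 h2

end Gauss

/-! ### The discriminant -/

section Disc

/-- `√(N² + 4κ)`. The numbers `(disc κ N + N)/2` and `(disc κ N - N)/2` are the non-negative
solutions of `z₁ z₂ = κ`, `z₁ - z₂ = N`. -/
noncomputable def disc (κ N : ℝ) : ℝ := √(N ^ 2 + 4 * κ)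

theorem disc_nonneg (κ N : ℝ) : 0 ≤ disc κ N := Real.sqrt_nonneg _

theorem disc_sq {κ : ℝ} (hκ : 0 ≤ κ) (N : ℝ) : disc κ N ^ 2 = N ^ 2 + 4 * κ :=
  Real.sq_sqrt (by positivity)

theorem disc_neg (κ N : ℝ) : disc κ (-N) = disc κ N := by simp [disc]

theorem abs_le_disc {κ : ℝ} (hκ : 0 ≤ κ) (N : ℝ) : |N| ≤ disc κ N := by
  rw [disc, ← Real.sqrt_sq_eq_abs]
  exact Real.sqrt_le_sqrt (by linarith)

theorem disc_mono {κ κ' : ℝ} (h : κ ≤ κ') (N : ℝ) : disc κ N ≤ disc κ' N :=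
  Real.sqrt_le_sqrt (by linarith)

theorem disc_eq_of_mul_eq {z₁ z₂ : ℝ} (h₁ : 0 ≤ z₁) (h₂ : 0 ≤ z₂) :
    disc (z₁ * z₂) (z₁ - z₂) = z₁ + z₂ := by
  rw [disc, show (z₁ - z₂) ^ 2 + 4 * (z₁ * z₂) = (z₁ + z₂) ^ 2 by ring]
  exact Real.sqrt_sq (by positivity)

theorem disc_pos_of_add_mul_pos {κ N δ : ℝ} (hκ : 0 ≤ κ) (h : 0 < disc κ N + δ * N) :
    0 < disc κ N := by
  rcases (disc_nonneg κ N).lt_or_eq with h0 | h0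
  · exact h0
  · have h1 := abs_le_disc hκ N
    rw [← h0] at h1 h
    have : N = 0 := abs_eq_zero.1 (le_antisymm h1 (abs_nonneg _))
    simp [this] at h

theorem hasDerivAt_disc {κ N : ℝ} (h : 0 < disc κ N) :
    HasDerivAt (disc κ) (N / disc κ N) N := by
  have h0 : N ^ 2 + 4 * κ ≠ 0 := by
    intro h0; rw [disc, h0, Real.sqrt_zero] at h; exact lt_irrefl _ h
  have h1 : HasDerivAt (fun N : ℝ => N ^ 2 + 4 * κ) (2 * N) N := by
    simpa using (hasDerivAt_pow 2 N).add_const (4 * κ)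
  refine (h1.sqrt h0).congr_deriv ?_
  change 2 * N / (2 * disc κ N) = _
  field_simp

end Disc

/-! ### The β-field on one vertex -/

section OnePoint

theorem betaMatrix_fin_one_posDef_iff (W : Matrix (Fin 1) (Fin 1) ℝ) (β : Fin 1 → ℝ) :
    (betaMatrix W β).PosDef ↔ W 0 0 < 2 * β 0 := by
  constructor
  · intro h
    have := h.diag_pos (i := 0)
    simp [betaMatrix] at this
    exact this
  · intro h
    have : betaMatrix W β = Matrix.diagonal (fun _ => 2 * β 0 - W 0 0) := by
      ext i j
      fin_cases i; fin_cases j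
      simp [betaMatrix]
    rw [this]
    exact Matrix.PosDef.diagonal (fun _ => by linarith)

theorem greenForm_fin_one (H : Matrix (Fin 1) (Fin 1) ℝ) (X Y : Fin 1 → ℝ) :
    greenForm H X Y = X 0 * Y 0 / H 0 0 := by
  simp [greenForm, dotProduct, Matrix.mulVec]
  ring

theorem betaDensity_fin_one {W : Matrix (Fin 1) (Fin 1) ℝ} (hW : 0 ≤ W 0 0) (η : Fin 1 → ℝ)
    {β : Fin 1 → ℝ} {s : ℝ} (hs : 0 < s) (hβ : 2 * β 0 - W 0 0 = s) :
    betaDensity W η β = √(2 / Real.pi) *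
      Real.exp (-(1 / 2) * (s + η 0 ^ 2 / s - 2 * η 0)) / √s := by
  have h00 : betaMatrix W β 0 0 = s := by simp [betaMatrix, ← hβ]
  rw [betaDensity_of_posDef (fun i => by fin_cases i; exact hW) _
    ((betaMatrix_fin_one_posDef_iff W β).2 (by linarith)), betaEnergy, greenForm_fin_one,
    Matrix.det_fin_one, h00]
  simp [dotProduct, Matrix.mulVec, h00, pow_two]

/-- The one-vertex β-field in terms of a Gaussian: with `N` a Gaussian variable tilted by
`1 + N / √(N² + 4η)`, the Schur complement is `z²`, where `z > 0` solves `z - η/z = N`. -/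
theorem lintegral_betaDensity_fin_one {W : Matrix (Fin 1) (Fin 1) ℝ} (hW : 0 ≤ W 0 0)
    {η : Fin 1 → ℝ} (hη : 0 ≤ η 0) (F : (Fin 1 → ℝ) → ℝ≥0∞) :
    ∫⁻ β, ENNReal.ofReal (betaDensity W η β) * F β =
      ∫⁻ N, ENNReal.ofReal ((disc (η 0) N + N) / disc (η 0) N) *
        F (fun _ => (((disc (η 0) N + N) / 2) ^ 2 + W 0 0) / 2) ∂gauss := by
  set e := η 0 with he
  set u := W 0 0 with hu
  set Φ : ℝ → ℝ := fun N => (((disc e N + N) / 2) ^ 2 + u) / 2 with hΦ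
  set R : Set ℝ := {N | 0 < disc e N + N} with hR
  have hDc : Continuous (disc e) := by
    unfold disc; fun_prop
  have hRm : MeasurableSet R := (isOpen_lt continuous_const (by fun_prop)).measurableSet
  have hDpos : ∀ N ∈ R, 0 < disc e N := fun N hN =>
    disc_pos_of_add_mul_pos (δ := 1) hη (by rw [one_mul]; exact hN)
  have hderiv : ∀ N ∈ R, HasDerivWithinAt Φ (((disc e N + N) / 2) ^ 2 / disc e N) R N := by
    intro N hN
    have hD := hDpos N hN
    have h1 := ((((((hasDerivAt_disc hD).add (hasDerivAt_id N)).div_const 2).pow 2).add_const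
      u).div_const 2).hasDerivWithinAt (s := R)
    refine h1.congr_deriv ?_
    simp
    field_simp
    ring
  have hinj : Set.InjOn Φ R := by
    intro N hN N' hN' h
    have h1 : ((disc e N + N) / 2) ^ 2 = ((disc e N' + N') / 2) ^ 2 := by
      simp only [hΦ] at h; linarith
    have hN0 : 0 < disc e N + N := hN
    have hN0' : 0 < disc e N' + N' := hN'
    have h2 : (disc e N + N) / 2 = (disc e N' + N') / 2 :=
      (pow_left_inj₀ (by positivity) (by positivity) two_ne_zero).1 h1
    have h3 := disc_sq hη N
    have h4 := disc_sq hη N'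
    have h5 : (disc e N + N) * (disc e N - N) = (disc e N' + N') * (disc e N' - N') := by
      linarith
    have h6 : disc e N + N = disc e N' + N' := by linarith
    rw [h6] at h5
    have h7 := mul_left_cancel₀ hN0'.ne' h5
    linarith
  have himage : Φ '' R = Set.Ioi (u / 2) := by
    ext t
    simp only [Set.mem_image, Set.mem_Ioi]
    constructor
    · rintro ⟨N, hN, rfl⟩
      have hN0 : 0 < disc e N + N := hN
      have : 0 < ((disc e N + N) / 2) ^ 2 := by positivity
      simp only [hΦ]; linarith
    · intro ht
      set z := √(2 * t - u) with hz
      have hz0 : 0 < z := Real.sqrt_pos.2 (by linarith)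
      have hz2 : z ^ 2 = 2 * t - u := Real.sq_sqrt (by linarith)
      have hd : disc e (z - e / z) = z + e / z := by
        have := disc_eq_of_mul_eq hz0.le (div_nonneg hη hz0.le)
        rwa [mul_div_cancel₀ _ hz0.ne'] at this
      refine ⟨z - e / z, ?_, ?_⟩
      · rw [hR, Set.mem_ofPred_eq, hd]; linarith
      · simp only [hΦ, hd]
        rw [show (z + e / z + (z - e / z)) / 2 = z by ring, hz2]; ring
  have h1 : ∫⁻ β, ENNReal.ofReal (betaDensity W η β) * F β =
      ∫⁻ t, ENNReal.ofReal (betaDensity W η (fun _ => t)) * F (fun _ => t) := by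
    exact ((volume_preserving_funUnique (Fin 1) ℝ).symm.lintegral_comp_emb
      (MeasurableEquiv.measurableEmbedding _) _).symm
  rw [h1, ← setLIntegral_eq_of_support_subset (s := Φ '' R),
    lintegral_image_eq_lintegral_abs_deriv_mul hRm hderiv hinj, lintegral_gauss]
  · rw [← lintegral_indicator hRm]
    refine lintegral_congr fun N => ?_
    by_cases hN : N ∈ R
    · rw [Set.indicator_of_mem hN, ← mul_assoc, ← mul_assoc]
      have hD := hDpos N hN
      have hN0 : 0 < disc e N + N := hN
      have hsq := disc_sq hη N
      rw [← ENNReal.ofReal_mul (abs_nonneg _), ← ENNReal.ofReal_mul (gaussDens_nonneg _)]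
      congr 2
      rw [betaDensity_fin_one hW η (s := ((disc e N + N) / 2) ^ 2) (by positivity)
        (by simp only [hΦ]; ring), ← he, abs_of_nonneg (by positivity),
        Real.sqrt_sq (by positivity), gaussDens]
      have h2 : ((disc e N + N) / 2) ^ 2 + e ^ 2 / ((disc e N + N) / 2) ^ 2 - 2 * e = N ^ 2 := by
        have h3 : e = (disc e N + N) / 2 * ((disc e N - N) / 2) := by linarith
        have h4 : e / ((disc e N + N) / 2) = (disc e N - N) / 2 := by
          rw [div_eq_iff (by positivity)]; linarith
        rw [← div_pow, h4]; linarith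
      rw [h2, show -(1 / 2) * N ^ 2 = -(N ^ 2 / 2) by ring]
      have h5 : √(2 / Real.pi) = 2 * (√(2 * Real.pi))⁻¹ := by
        rw [← Real.sqrt_inv, show (2 / Real.pi) = 2 ^ 2 * (2 * Real.pi)⁻¹ by field_simp,
          Real.sqrt_mul (by positivity), Real.sqrt_sq (by positivity)]
      rw [h5]
      field_simp
    · rw [Set.indicator_of_notMem hN]
      have : (disc e N + N) / disc e N ≤ 0 :=
        div_nonpos_of_nonpos_of_nonneg (not_lt.1 hN) (disc_nonneg _ _)
      rw [ENNReal.ofReal_of_nonpos this]; simp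
  · intro t ht
    rw [himage]
    by_contra hlt
    refine ht ?_
    change ENNReal.ofReal (betaDensity W η (fun _ => t)) * F (fun _ => t) = 0
    rw [betaDensity_of_not_posDef, ENNReal.ofReal_zero, zero_mul]
    rw [betaMatrix_fin_one_posDef_iff]
    simp only [Set.mem_Ioi] at hlt
    linarith

end OnePoint

/-! ### The β-field on two vertices -/

section TwoPoint

/-- The product `z₁ z₂` in `S = m² x̂ x̂ᵀ + z zᵀ` with `x̂ = ((1 - δ)/2, (1 + δ)/2)` and
`z = (z₁, -z₂)`, when the off-diagonal entry of `S` is `-c`. -/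
noncomputable def pairKappa (c δ m : ℝ) : ℝ := c + m ^ 2 * ((1 - δ ^ 2) / 4)

/-- The sum `z₁ + z₂ = √(N² + 4κ)` with `κ = pairKappa c δ m` and `N = z₁ - z₂`. -/
noncomputable def pairDisc (c δ m N : ℝ) : ℝ := disc (pairKappa c δ m) N

/-- The two diagonal entries of `m² x̂ x̂ᵀ + z zᵀ`, where `x̂ = ((1 - δ)/2, (1 + δ)/2)` and
`z = (z₁, -z₂)` with `z₁, z₂ ≥ 0`, `z₁ - z₂ = N` and off-diagonal entry `-c`. -/
noncomputable def pairDiag (c δ m N : ℝ) : Fin 2 → ℝ :=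
  ![(m * ((1 - δ) / 2)) ^ 2 + ((pairDisc c δ m N + N) / 2) ^ 2,
    (m * ((1 + δ) / 2)) ^ 2 + ((pairDisc c δ m N - N) / 2) ^ 2]

/-- The tilt which turns the Gaussian law of `(m, N)` into the law of the two-vertex β-field. -/
noncomputable def pairWeight (c δ m N : ℝ) : ℝ :=
  (pairDisc c δ m N + δ * N) / pairDisc c δ m N

variable {c δ : ℝ}

theorem pairKappa_nonneg (hc : 0 ≤ c) (hδ : |δ| ≤ 1) (m : ℝ) : 0 ≤ pairKappa c δ m := by
  have : δ ^ 2 ≤ 1 := by rwa [sq_le_one_iff_abs_le_one]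
  unfold pairKappa
  have h := mul_nonneg (sq_nonneg m) (show 0 ≤ (1 - δ ^ 2) / 4 by linarith)
  linarith

theorem pairDisc_sq (hc : 0 ≤ c) (hδ : |δ| ≤ 1) (m N : ℝ) :
    pairDisc c δ m N ^ 2 = N ^ 2 + 4 * c + m ^ 2 * (1 - δ ^ 2) := by
  rw [pairDisc, disc_sq (pairKappa_nonneg hc hδ m), pairKappa]; ring

theorem pairDisc_nonneg (c δ m N : ℝ) : 0 ≤ pairDisc c δ m N := disc_nonneg _ _

theorem pairDisc_neg (c δ m N : ℝ) : pairDisc c δ m (-N) = pairDisc c δ m N := disc_neg _ _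

theorem pairDisc_neg_left (c δ m N : ℝ) : pairDisc c δ (-m) N = pairDisc c δ m N := by
  simp [pairDisc, pairKappa]

theorem abs_mul_le_pairDisc (hc : 0 ≤ c) (hδ : |δ| ≤ 1) (m N : ℝ) :
    |δ * N| ≤ pairDisc c δ m N := by
  rw [abs_mul]
  calc |δ| * |N| ≤ 1 * |N| := mul_le_mul_of_nonneg_right hδ (abs_nonneg _)
    _ = |N| := one_mul _
    _ ≤ _ := abs_le_disc (pairKappa_nonneg hc hδ m) N

theorem pairWeight_nonneg (hc : 0 ≤ c) (hδ : |δ| ≤ 1) (m N : ℝ) : 0 ≤ pairWeight c δ m N := by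
  have h := neg_abs_le (δ * N)
  have h' := abs_mul_le_pairDisc hc hδ m N
  exact div_nonneg (by linarith) (pairDisc_nonneg _ _ _ _)

theorem continuous_pairDisc : Continuous (fun p : ℝ × ℝ × ℝ × ℝ =>
    pairDisc p.1 p.2.1 p.2.2.1 p.2.2.2) := by
  unfold pairDisc pairKappa disc; fun_prop

/-- The determinant of `m² x̂ x̂ᵀ + z zᵀ` is the square of `m` times the determinant of
the pair `x̂`, `z`. -/
theorem pairDiag_det (hc : 0 ≤ c) (hδ : |δ| ≤ 1) (m N : ℝ) :
    pairDiag c δ m N 0 * pairDiag c δ m N 1 - c ^ 2 =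
      (m * ((pairDisc c δ m N + δ * N) / 2)) ^ 2 := by
  have h : c = (pairDisc c δ m N ^ 2 - N ^ 2 - m ^ 2 * (1 - δ ^ 2)) / 4 := by
    rw [pairDisc_sq hc hδ]; ring
  conv_lhs => rw [show c ^ 2 = ((pairDisc c δ m N ^ 2 - N ^ 2 - m ^ 2 * (1 - δ ^ 2)) / 4) ^ 2 by
    rw [← h]]
  simp only [pairDiag, Matrix.cons_val_zero, Matrix.cons_val_one]
  ring

theorem pairDiag_sum (hc : 0 ≤ c) (hδ : |δ| ≤ 1) (m N : ℝ) :
    pairDiag c δ m N 0 + pairDiag c δ m N 1 - 2 * c = m ^ 2 + N ^ 2 := by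
  have h := pairDisc_sq hc hδ m N
  simp only [pairDiag, Matrix.cons_val_zero, Matrix.cons_val_one]
  linarith [show (pairDisc c δ m N + N) ^ 2 + (pairDisc c δ m N - N) ^ 2 =
    2 * pairDisc c δ m N ^ 2 + 2 * N ^ 2 by ring]

theorem pairDiag_neg_left (c δ m N : ℝ) : pairDiag c δ (-m) N = pairDiag c δ m N := by
  simp [pairDiag, pairDisc_neg_left]

theorem pairWeight_neg_left (c δ m N : ℝ) : pairWeight c δ (-m) N = pairWeight c δ m N := by
  simp [pairWeight, pairDisc_neg_left]

theorem betaMatrix_fin_two_posDef_iff {W : Matrix (Fin 2) (Fin 2) ℝ} (hW : W.IsSymm)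
    (β : Fin 2 → ℝ) :
    (betaMatrix W β).PosDef ↔ 0 < 2 * β 0 - W 0 0 ∧
      W 0 1 ^ 2 < (2 * β 0 - W 0 0) * (2 * β 1 - W 1 1) := by
  have h10 : W 1 0 = W 0 1 := hW.apply 0 1
  have hdet : (betaMatrix W β).det =
      (2 * β 0 - W 0 0) * (2 * β 1 - W 1 1) - W 0 1 ^ 2 := by
    rw [Matrix.det_fin_two]; simp [betaMatrix, h10]; ring
  constructor
  · intro h
    have h1 := h.diag_pos (i := 0)
    have h2 := h.det_pos
    rw [hdet] at h2
    simp [betaMatrix] at h1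
    exact ⟨by linarith, by linarith⟩
  · rintro ⟨h1, h2⟩
    refine Matrix.PosDef.of_dotProduct_mulVec_pos ?_ ?_
    · rw [Matrix.IsHermitian, Matrix.conjTranspose_eq_transpose_of_trivial, betaMatrix,
        Matrix.transpose_sub, hW, Matrix.diagonal_transpose]
    · intro x hx
      set a := 2 * β 0 - W 0 0 with ha
      set b := 2 * β 1 - W 1 1 with hb
      have hq : star x ⬝ᵥ (betaMatrix W β *ᵥ x) =
          a * x 0 ^ 2 - 2 * W 0 1 * x 0 * x 1 + b * x 1 ^ 2 := by
        simp [dotProduct, Matrix.mulVec, Fin.sum_univ_two, betaMatrix, h10, ha, hb]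
        ring
      rw [hq]
      have hsq : a * (a * x 0 ^ 2 - 2 * W 0 1 * x 0 * x 1 + b * x 1 ^ 2) =
          (a * x 0 - W 0 1 * x 1) ^ 2 + (a * b - W 0 1 ^ 2) * x 1 ^ 2 := by ring
      refine pos_of_mul_pos_right (a := a) ?_ h1.le
      rw [hsq]
      by_cases hx1 : x 1 = 0
      · have hx0 : x 0 ≠ 0 := by
          intro hx0; apply hx; ext i; fin_cases i <;> assumption
        rw [hx1]
        have : 0 < (a * x 0) ^ 2 := by positivity
        nlinarith
      · have : 0 < (a * b - W 0 1 ^ 2) * x 1 ^ 2 :=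
          mul_pos (by linarith) (by positivity)
        nlinarith [sq_nonneg (a * x 0 - W 0 1 * x 1)]

theorem betaDensity_fin_two {W : Matrix (Fin 2) (Fin 2) ℝ} (hW : W.IsSymm)
    (hd : ∀ i, 0 ≤ W i i) {β : Fin 2 → ℝ} {a b : ℝ} (ha : 2 * β 0 - W 0 0 = a)
    (hb : 2 * β 1 - W 1 1 = b) (ha0 : 0 < a) (hab : W 0 1 ^ 2 < a * b) :
    betaDensity W 0 β = 2 / Real.pi *
      Real.exp (-(1 / 2) * (a + b - 2 * W 0 1)) / √(a * b - W 0 1 ^ 2) := by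
  have h10 : W 1 0 = W 0 1 := hW.apply 0 1
  have hP := (betaMatrix_fin_two_posDef_iff hW β).2 ⟨by linarith, by rw [ha, hb]; exact hab⟩
  have hE : betaEnergy W 0 β = a + b - 2 * W 0 1 := by
    simp [betaEnergy, greenForm, dotProduct, Matrix.mulVec, Fin.sum_univ_two, betaMatrix, h10]
    linarith
  have hdet : (betaMatrix W β).det = a * b - W 0 1 ^ 2 := by
    rw [Matrix.det_fin_two, ← ha, ← hb]; simp [betaMatrix, h10]; ring
  rw [betaDensity_of_posDef hd _ hP, hE, hdet, Fintype.card_fin, Real.sq_sqrt (by positivity)]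

/-- The chart `(m, N) ↦ β` of the two-vertex β-field with diagonal weights `u`, `v`. -/
noncomputable def pairChart (c δ u v : ℝ) (p : ℝ × ℝ) : ℝ × ℝ :=
  ((pairDiag c δ p.1 p.2 0 + u) / 2, (pairDiag c δ p.1 p.2 1 + v) / 2)

/-- The domain of the chart. -/
def pairDomain (c δ : ℝ) : Set (ℝ × ℝ) := {p | 0 < p.1 ∧ 0 < pairDisc c δ p.1 p.2 + δ * p.2}

theorem measurableSet_pairDomain (c δ : ℝ) : MeasurableSet (pairDomain c δ) := by
  have h : Continuous (fun p : ℝ × ℝ => pairDisc c δ p.1 p.2) := by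
    unfold pairDisc pairKappa disc; fun_prop
  exact ((isOpen_lt continuous_const continuous_fst).inter
    (isOpen_lt continuous_const (h.add (continuous_const.mul continuous_snd)))).measurableSet

theorem pairDisc_pos_of_mem (hc : 0 ≤ c) (hδ : |δ| ≤ 1) {p : ℝ × ℝ} (hp : p ∈ pairDomain c δ) :
    0 < pairDisc c δ p.1 p.2 :=
  disc_pos_of_add_mul_pos (pairKappa_nonneg hc hδ _) hp.2

/-- The derivative of `pairChart`. -/
noncomputable def pairChartDeriv (c δ : ℝ) (p : ℝ × ℝ) : ℝ × ℝ →L[ℝ] ℝ × ℝ :=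
  (Matrix.toLin (.finTwoProd ℝ) (.finTwoProd ℝ)
    !![p.1 * ((1 - δ) / 2) ^ 2 + (pairDisc c δ p.1 p.2 + p.2) / 4 *
          (p.1 * (1 - δ ^ 2) / pairDisc c δ p.1 p.2),
        (pairDisc c δ p.1 p.2 + p.2) ^ 2 / (4 * pairDisc c δ p.1 p.2);
      p.1 * ((1 + δ) / 2) ^ 2 + (pairDisc c δ p.1 p.2 - p.2) / 4 *
          (p.1 * (1 - δ ^ 2) / pairDisc c δ p.1 p.2),
        -(pairDisc c δ p.1 p.2 - p.2) ^ 2 / (4 * pairDisc c δ p.1 p.2)]).toContinuousLinearMap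

theorem det_pairChartDeriv {p : ℝ × ℝ} (hp : 0 < pairDisc c δ p.1 p.2) :
    (pairChartDeriv c δ p).det =
      -(p.1 * (pairDisc c δ p.1 p.2 + δ * p.2) ^ 2 / (4 * pairDisc c δ p.1 p.2)) := by
  unfold pairChartDeriv
  simp only [LinearMap.det_toContinuousLinearMap, LinearMap.det_toLin, Matrix.det_fin_two_of]
  field_simp
  ring

theorem hasFDerivAt_pairDisc {p : ℝ × ℝ} (hp : 0 < pairDisc c δ p.1 p.2) :
    HasFDerivAt (fun p : ℝ × ℝ => pairDisc c δ p.1 p.2)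
      ((p.1 * (1 - δ ^ 2) / pairDisc c δ p.1 p.2) • ContinuousLinearMap.fst ℝ ℝ ℝ +
        (p.2 / pairDisc c δ p.1 p.2) • ContinuousLinearMap.snd ℝ ℝ ℝ) p := by
  have h0 : p.2 ^ 2 + 4 * (c + p.1 ^ 2 * ((1 - δ ^ 2) / 4)) ≠ 0 := by
    intro h0
    rw [pairDisc, disc, pairKappa, h0, Real.sqrt_zero] at hp; exact lt_irrefl _ hp
  have h1 : HasFDerivAt (fun p : ℝ × ℝ => p.2 ^ 2 + 4 * (c + p.1 ^ 2 * ((1 - δ ^ 2) / 4)))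
      ((2 * p.1 * (1 - δ ^ 2)) • ContinuousLinearMap.fst ℝ ℝ ℝ +
        (2 * p.2) • ContinuousLinearMap.snd ℝ ℝ ℝ) p := by
    have := (hasFDerivAt_snd (𝕜 := ℝ) (p := p)).pow 2 |>.add
      ((((hasFDerivAt_fst (𝕜 := ℝ) (p := p)).pow 2).mul_const ((1 - δ ^ 2) / 4)).const_add c
        |>.const_mul 4)
    refine this.congr_fderiv ?_
    ext <;> simp
    ring
  refine (h1.sqrt h0).congr_fderiv ?_
  have hD : √(p.2 ^ 2 + 4 * (c + p.1 ^ 2 * ((1 - δ ^ 2) / 4))) = pairDisc c δ p.1 p.2 := rfl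
  rw [hD]
  ext <;> simp <;> field_simp

theorem hasFDerivAt_pairChart (u v : ℝ) {p : ℝ × ℝ} (hp : 0 < pairDisc c δ p.1 p.2) :
    HasFDerivAt (pairChart c δ u v) (pairChartDeriv c δ p) p := by
  have hD := hasFDerivAt_pairDisc hp
  have h1 := (((((hasFDerivAt_fst (𝕜 := ℝ) (p := p)).mul_const ((1 - δ) / 2)).pow 2).add
    (((hD.add hasFDerivAt_snd).mul_const (2⁻¹ : ℝ)).pow 2)).add_const u).mul_const (2⁻¹ : ℝ)
  have h2 := (((((hasFDerivAt_fst (𝕜 := ℝ) (p := p)).mul_const ((1 + δ) / 2)).pow 2).add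
    (((hD.sub hasFDerivAt_snd).mul_const (2⁻¹ : ℝ)).pow 2)).add_const v).mul_const (2⁻¹ : ℝ)
  have h3 := h1.prodMk h2
  have hfun : pairChart c δ u v = fun p : ℝ × ℝ =>
      (((p.1 * ((1 - δ) / 2)) ^ 2 + ((pairDisc c δ p.1 p.2 + p.2) * 2⁻¹) ^ 2 + u) * 2⁻¹,
        ((p.1 * ((1 + δ) / 2)) ^ 2 + ((pairDisc c δ p.1 p.2 - p.2) * 2⁻¹) ^ 2 + v) * 2⁻¹) := by
    funext p
    simp [pairChart, pairDiag, div_eq_mul_inv]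
  rw [hfun]
  refine h3.congr_fderiv ?_
  unfold pairChartDeriv
  rw [Matrix.toLin_finTwoProd_toContinuousLinearMap]
  ext <;> simp <;> field_simp <;> ring

theorem injOn_pairChart (hc : 0 ≤ c) (hδ : |δ| ≤ 1) (u v : ℝ) :
    Set.InjOn (pairChart c δ u v) (pairDomain c δ) := by
  -- `t = (D + δN)/2`, `m` and `z` are determined by `a`, `b` and `c`.
  have key : ∀ p ∈ pairDomain c δ,
      ((pairDisc c δ p.1 p.2 + δ * p.2) / 2) ^ 2 =
        pairDiag c δ p.1 p.2 1 * ((1 - δ) / 2) ^ 2 + c * (1 - δ ^ 2) / 2 +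
          pairDiag c δ p.1 p.2 0 * ((1 + δ) / 2) ^ 2 ∧
      p.2 * ((pairDisc c δ p.1 p.2 + δ * p.2) / 2) =
        (pairDiag c δ p.1 p.2 0 * ((1 + δ) / 2) + c * ((1 - δ) / 2)) -
        (pairDiag c δ p.1 p.2 1 * ((1 - δ) / 2) + c * ((1 + δ) / 2)) := by
    intro p hp
    have h : c = (pairDisc c δ p.1 p.2 ^ 2 - p.2 ^ 2 - p.1 ^ 2 * (1 - δ ^ 2)) / 4 := by
      rw [pairDisc_sq hc hδ]; ring
    generalize hD : pairDisc c δ p.1 p.2 = D at h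
    simp only [pairDiag, hD, Matrix.cons_val_zero, Matrix.cons_val_one]
    rw [h]
    constructor <;> ring
  intro p hp q hq hpq
  simp only [pairChart, Prod.mk.injEq] at hpq
  have h0 : pairDiag c δ p.1 p.2 0 = pairDiag c δ q.1 q.2 0 := by linarith [hpq.1]
  have h1 : pairDiag c δ p.1 p.2 1 = pairDiag c δ q.1 q.2 1 := by linarith [hpq.2]
  obtain ⟨kp1, kp2⟩ := key p hp
  obtain ⟨kq1, kq2⟩ := key q hq
  rw [h0, h1, ← kq1] at kp1
  rw [h0, h1, ← kq2] at kp2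
  have hp2 := hp.2
  have hq2 := hq.2
  have ht : (pairDisc c δ p.1 p.2 + δ * p.2) / 2 = (pairDisc c δ q.1 q.2 + δ * q.2) / 2 :=
    (pow_left_inj₀ (by positivity) (by positivity) two_ne_zero).1 kp1
  have hdp := pairDiag_det hc hδ p.1 p.2
  have hdq := pairDiag_det hc hδ q.1 q.2
  rw [h0, h1, hdq, ht] at hdp
  have hp1 := hp.1
  have hq1 := hq.1
  have hm := (pow_left_inj₀ (by positivity) (by positivity) two_ne_zero).1 hdp
  rw [ht] at kp2
  exact Prod.ext (mul_right_cancel₀ (by positivity) hm).symm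
    (mul_right_cancel₀ (by positivity) kp2)

/-- The chart covers all positive definite matrices: `z` is read off from `S` as
`S (x̂₁, -x̂₀) / √((x̂₁, -x̂₀)ᵀ S (x̂₁, -x̂₀))`. -/
theorem image_pairChart (hc : 0 ≤ c) (hδ : |δ| ≤ 1) (u v : ℝ) :
    pairChart c δ u v '' pairDomain c δ =
      {q | 0 < 2 * q.1 - u ∧ c ^ 2 < (2 * q.1 - u) * (2 * q.2 - v)} := by
  obtain ⟨hδ1, hδ2⟩ := abs_le.1 hδ
  ext q
  simp only [Set.mem_image, Set.mem_ofPred_eq]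
  constructor
  · rintro ⟨p, hp, rfl⟩
    have hp1 := hp.1
    have hp2 := hp.2
    have hdet := pairDiag_det hc hδ p.1 p.2
    have hpos : 0 < (p.1 * ((pairDisc c δ p.1 p.2 + δ * p.2) / 2)) ^ 2 := by positivity
    have ha : 0 ≤ pairDiag c δ p.1 p.2 0 := by
      simp only [pairDiag, Matrix.cons_val_zero]; positivity
    simp only [pairChart]
    rw [show 2 * ((pairDiag c δ p.1 p.2 0 + u) / 2) - u = pairDiag c δ p.1 p.2 0 by ring,
      show 2 * ((pairDiag c δ p.1 p.2 1 + v) / 2) - v = pairDiag c δ p.1 p.2 1 by ring]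
    refine ⟨ha.lt_of_ne ?_, by linarith⟩
    intro h0
    rw [← h0] at hdet
    nlinarith [sq_nonneg c]
  · rintro ⟨ha, hab⟩
    set a := 2 * q.1 - u with hadef
    set b := 2 * q.2 - v with hbdef
    have hb : 0 < b := by
      by_contra hb
      nlinarith [sq_nonneg c, mul_nonneg ha.le (neg_nonneg.2 (not_lt.1 hb))]
    set x := (1 - δ) / 2 with hx
    set y := (1 + δ) / 2 with hy
    have hx0 : 0 ≤ x := by linarith
    have hy0 : 0 ≤ y := by linarith
    have hxy : x + y = 1 := by rw [hx, hy]; ring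
    set Q := b * x ^ 2 + 2 * c * x * y + a * y ^ 2 with hQ
    have hQ0 : 0 < Q := by
      rcases hx0.lt_or_eq with h | h
      · have : 0 < b * x ^ 2 := by positivity
        have : 0 ≤ 2 * c * x * y := by positivity
        have : 0 ≤ a * y ^ 2 := by positivity
        linarith
      · have hy1 : y = 1 := by linarith
        rw [hQ, ← h, hy1]; simp; exact ha
    set t := √Q with ht
    have ht0 : 0 < t := Real.sqrt_pos.2 hQ0
    have htQ : t ^ 2 = Q := Real.sq_sqrt hQ0.le
    set m := √(a * b - c ^ 2) / t with hm
    have hm0 : 0 < m := div_pos (Real.sqrt_pos.2 (by linarith)) ht0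
    have hmQ : m ^ 2 = (a * b - c ^ 2) / Q := by
      rw [hm, div_pow, Real.sq_sqrt (by linarith), htQ]
    set z₁ := (a * y + c * x) / t with hz₁
    set z₂ := (b * x + c * y) / t with hz₂
    have hz₁0 : 0 ≤ z₁ := by positivity
    have hz₂0 : 0 ≤ z₂ := by positivity
    have hκ : pairKappa c δ m = z₁ * z₂ := by
      rw [pairKappa, hmQ, hz₁, hz₂, div_mul_div_comm (a * y + c * x), ← pow_two t, htQ,
        show (1 - δ ^ 2) / 4 = x * y by rw [hx, hy]; ring]
      field_simp
      rw [hQ]; ring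
    have hD : pairDisc c δ m (z₁ - z₂) = z₁ + z₂ := by
      rw [pairDisc, hκ, disc_eq_of_mul_eq hz₁0 hz₂0]
    refine ⟨(m, z₁ - z₂), ⟨hm0, ?_⟩, ?_⟩
    · change 0 < pairDisc c δ m (z₁ - z₂) + δ * (z₁ - z₂)
      have h1 : z₁ + z₂ + δ * (z₁ - z₂) = 2 * (x * z₂ + y * z₁) := by rw [hx, hy]; ring
      have h2 : x * z₂ + y * z₁ = Q / t := by rw [hz₁, hz₂, hQ]; field_simp; ring
      rw [hD, h1, h2]; positivity
    · have h1 : (m * x) ^ 2 + z₁ ^ 2 = a := by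
        rw [mul_pow, hmQ, hz₁, div_pow (a * y + c * x), htQ]
        field_simp
        rw [hQ]; ring
      have h2 : (m * y) ^ 2 + z₂ ^ 2 = b := by
        rw [mul_pow, hmQ, hz₂, div_pow (b * x + c * y), htQ]
        field_simp
        rw [hQ]; ring
      simp only [pairChart, pairDiag, hD, Matrix.cons_val_zero, Matrix.cons_val_one]
      rw [show (z₁ + z₂ + (z₁ - z₂)) / 2 = z₁ by ring,
        show (z₁ + z₂ - (z₁ - z₂)) / 2 = z₂ by ring, ← hx, ← hy, h1, h2]
      ext <;> simp [hadef, hbdef]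

theorem measurable_pairDiag (c δ : ℝ) :
    Measurable (fun p : ℝ × ℝ => pairDiag c δ p.1 p.2) := by
  refine measurable_pi_iff.2 fun i => ?_
  fin_cases i <;>
  · simp [pairDiag, pairDisc, pairKappa, disc]
    fun_prop

theorem measurable_pairWeight (c δ : ℝ) :
    Measurable (fun p : ℝ × ℝ => pairWeight c δ p.1 p.2) := by
  unfold pairWeight pairDisc pairKappa disc
  fun_prop

theorem support_betaDensity_fin_two_subset {W : Matrix (Fin 2) (Fin 2) ℝ} (hW : W.IsSymm)
    (hc : 0 ≤ W 0 1) (hδ : |δ| ≤ 1) (F : (Fin 2 → ℝ) → ℝ≥0∞) :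
    (Function.support fun q : ℝ × ℝ =>
      ENNReal.ofReal (betaDensity W 0 ![q.1, q.2]) * F ![q.1, q.2]) ⊆
        pairChart (W 0 1) δ (W 0 0) (W 1 1) '' pairDomain (W 0 1) δ := by
  intro q hq
  rw [image_pairChart hc hδ]
  by_contra hlt
  refine hq ?_
  change ENNReal.ofReal (betaDensity W 0 ![q.1, q.2]) * F ![q.1, q.2] = 0
  rw [betaDensity_of_not_posDef, ENNReal.ofReal_zero, zero_mul]
  rw [betaMatrix_fin_two_posDef_iff hW]
  exact hlt

/-- The Jacobian of the chart cancels the square root of the determinant up to `pairWeight`. The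
factor `2` compensates for the restriction to `m > 0`. -/
theorem betaDensity_pairChart {W : Matrix (Fin 2) (Fin 2) ℝ} (hW : W.IsSymm)
    (hd : ∀ i, 0 ≤ W i i) (hc : 0 ≤ W 0 1) (hδ : |δ| ≤ 1) {p : ℝ × ℝ}
    (hp : p ∈ pairDomain (W 0 1) δ) :
    |(pairChartDeriv (W 0 1) δ p).det| *
      betaDensity W 0 ![(pairChart (W 0 1) δ (W 0 0) (W 1 1) p).1,
        (pairChart (W 0 1) δ (W 0 0) (W 1 1) p).2] =
    gaussDens p.1 * (2 * (gaussDens p.2 * pairWeight (W 0 1) δ p.1 p.2)) := by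
  have hD := pairDisc_pos_of_mem hc hδ hp
  have hdet := pairDiag_det hc hδ p.1 p.2
  have hsum := pairDiag_sum hc hδ p.1 p.2
  have himg : pairChart (W 0 1) δ (W 0 0) (W 1 1) p ∈
      pairChart (W 0 1) δ (W 0 0) (W 1 1) '' pairDomain (W 0 1) δ := ⟨p, hp, rfl⟩
  rw [image_pairChart hc hδ] at himg
  obtain ⟨h1, h2⟩ := himg
  obtain ⟨hp1, hp2⟩ := hp
  have ha : 2 * (pairChart (W 0 1) δ (W 0 0) (W 1 1) p).1 - W 0 0 =
      pairDiag (W 0 1) δ p.1 p.2 0 := by simp only [pairChart]; ring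
  have hb : 2 * (pairChart (W 0 1) δ (W 0 0) (W 1 1) p).2 - W 1 1 =
      pairDiag (W 0 1) δ p.1 p.2 1 := by simp only [pairChart]; ring
  rw [ha] at h1
  rw [ha, hb] at h2
  rw [betaDensity_fin_two hW hd (a := pairDiag (W 0 1) δ p.1 p.2 0)
    (b := pairDiag (W 0 1) δ p.1 p.2 1) ha hb h1 h2, det_pairChartDeriv hD, abs_neg,
    abs_of_nonneg (by positivity), hdet, hsum, Real.sqrt_sq (by positivity), gaussDens, gaussDens,
    pairWeight, show -(1 / 2) * (p.1 ^ 2 + p.2 ^ 2) = -(p.1 ^ 2 / 2) + -(p.2 ^ 2 / 2) by ring,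
    Real.exp_add]
  have hpi : (√(2 * Real.pi)) ^ 2 = 2 * Real.pi := Real.sq_sqrt (by positivity)
  generalize √(2 * Real.pi) = r at hpi
  have hr : r ≠ 0 := by
    rintro rfl
    have := Real.pi_pos
    norm_num at hpi
  field_simp
  rw [hpi]
  ring

/-- The two-vertex β-field in terms of two Gaussians: `S = m² x̂ x̂ᵀ + z zᵀ`, where
`1ᵀ x̂ = 1` and `N = 1ᵀ z`, so that `1ᵀ S 1 = m² + N²`. This holds for every direction `x̂` in the
positive quadrant, at the price of the tilt `pairWeight`. -/
theorem lintegral_betaDensity_fin_two {W : Matrix (Fin 2) (Fin 2) ℝ} (hW : W.IsSymm)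
    (hd : ∀ i, 0 ≤ W i i) (hc : 0 ≤ W 0 1) (hδ : |δ| ≤ 1) {F : (Fin 2 → ℝ) → ℝ≥0∞}
    (hF : Measurable F) :
    ∫⁻ β, ENNReal.ofReal (betaDensity W 0 β) * F β =
      ∫⁻ m, ∫⁻ N, ENNReal.ofReal (pairWeight (W 0 1) δ m N) *
        F (fun i => (pairDiag (W 0 1) δ m N i + W i i) / 2) ∂gauss ∂gauss := by
  set c := W 0 1 with hcdef
  set g : ℝ × ℝ → ℝ≥0∞ := fun p => ENNReal.ofReal (pairWeight c δ p.1 p.2) *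
    F (fun i => (pairDiag c δ p.1 p.2 i + W i i) / 2) with hg
  have hgm : Measurable g := by
    refine (measurable_pairWeight c δ).ennreal_ofReal.mul
      (hF.comp (measurable_pi_iff.2 fun i => ?_))
    have := (measurable_pi_iff.1 (measurable_pairDiag c δ)) i
    exact (this.add_const _).div_const _
  have hchart : ∀ p : ℝ × ℝ, F ![(pairChart c δ (W 0 0) (W 1 1) p).1,
      (pairChart c δ (W 0 0) (W 1 1) p).2] =
      F (fun i => (pairDiag c δ p.1 p.2 i + W i i) / 2) := by
    intro p
    congr 1
    ext i
    fin_cases i <;> simp [pairChart]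
  have h1 : ∫⁻ β, ENNReal.ofReal (betaDensity W 0 β) * F β =
      ∫⁻ q : ℝ × ℝ, ENNReal.ofReal (betaDensity W 0 ![q.1, q.2]) * F ![q.1, q.2] :=
    ((volume_preserving_finTwoArrow ℝ).symm.lintegral_comp_emb
      (MeasurableEquiv.measurableEmbedding _) _).symm
  have h2 : ∀ p : ℝ × ℝ, (pairDomain c δ).indicator (fun p =>
      ENNReal.ofReal |(pairChartDeriv c δ p).det| *
        (ENNReal.ofReal (betaDensity W 0 ![(pairChart c δ (W 0 0) (W 1 1) p).1,
          (pairChart c δ (W 0 0) (W 1 1) p).2]) *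
        F ![(pairChart c δ (W 0 0) (W 1 1) p).1, (pairChart c δ (W 0 0) (W 1 1) p).2])) p =
      ENNReal.ofReal (gaussDens p.1) * ((if 0 < p.1 then 2 else 0) *
        (ENNReal.ofReal (gaussDens p.2) * g p)) := by
    intro p
    by_cases hp : p ∈ pairDomain c δ
    · rw [Set.indicator_of_mem hp, ← mul_assoc, ← ENNReal.ofReal_mul (abs_nonneg _),
        betaDensity_pairChart hW hd hc hδ hp, if_pos hp.1, hchart,
        ENNReal.ofReal_mul (gaussDens_nonneg _), ENNReal.ofReal_mul (by norm_num),
        ENNReal.ofReal_mul (gaussDens_nonneg _), ENNReal.ofReal_ofNat]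
      simp only [hg, ← hcdef]
      ring
    · rw [Set.indicator_of_notMem hp]
      by_cases hp1 : 0 < p.1
      · have : pairWeight c δ p.1 p.2 ≤ 0 :=
          div_nonpos_of_nonpos_of_nonneg (not_lt.1 fun h => hp ⟨hp1, h⟩) (pairDisc_nonneg _ _ _ _)
        simp [hg, ENNReal.ofReal_of_nonpos this]
      · simp [hp1]
  have hgauss : Measurable fun x => ENNReal.ofReal (gaussDens x) :=
    measurable_gaussDens.ennreal_ofReal
  have hite : Measurable fun x : ℝ => if 0 < x then (2 : ℝ≥0∞) else 0 :=
    Measurable.ite measurableSet_Ioi measurable_const measurable_const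
  have hKm : Measurable fun m => ∫⁻ N, g (m, N) ∂gauss := hgm.lintegral_prod_right'
  -- The chart only covers `m > 0`, but the integrand is even in `m`.
  have h3 : ∫⁻ m, ∫⁻ N, g (m, N) ∂gauss ∂gauss =
      ∫⁻ m, (if 0 < m then 2 else 0) * ∫⁻ N, g (m, N) ∂gauss ∂gauss := by
    refine lintegral_gauss_congr_even hKm (hite.mul hKm) fun m hm => ?_
    have heven : ∫⁻ N, g (-m, N) ∂gauss = ∫⁻ N, g (m, N) ∂gauss := by
      simp only [hg, pairWeight_neg_left, pairDiag_neg_left]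
    rw [heven, ← two_mul]
    rcases hm.lt_or_gt with h | h
    · simp [h, h.not_gt]
    · simp [h, h.not_gt]
  rw [h1, ← setLIntegral_eq_of_support_subset
      (support_betaDensity_fin_two_subset hW (by rw [← hcdef]; exact hc) hδ F), ← hcdef,
    lintegral_image_eq_lintegral_abs_det_fderiv_mul volume (measurableSet_pairDomain c δ)
      (fun p hp => (hasFDerivAt_pairChart _ _ (pairDisc_pos_of_mem hc hδ hp)).hasFDerivWithinAt)
      (injOn_pairChart hc hδ _ _), ← lintegral_indicator (measurableSet_pairDomain c δ),
    lintegral_congr h2, Measure.volume_eq_prod, lintegral_prod]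
  · refine Eq.trans ?_ h3.symm
    rw [lintegral_gauss]
    refine lintegral_congr fun m => ?_
    have h4 : (if 0 < m then (2 : ℝ≥0∞) else 0) ≠ ∞ := by split_ifs <;> simp
    dsimp only
    rw [lintegral_const_mul' _ _ ENNReal.ofReal_ne_top, lintegral_const_mul' _ _ h4,
      lintegral_gauss]
  · exact ((hgauss.comp measurable_fst).mul ((hite.comp measurable_fst).mul
      ((hgauss.comp measurable_snd).mul hgm))).aemeasurable

end TwoPoint

/-! ### Measurability -/

section Measurability

variable {ι κ α : Type*} [MeasurableSpace α]

theorem measurable_matrix_iff {f : α → Matrix ι κ ℝ} :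
    Measurable f ↔ ∀ i j, Measurable fun a => f a i j := by
  constructor
  · intro h i j
    exact (measurable_pi_iff.1 ((measurable_pi_iff (X := fun _ : ι => κ → ℝ)).1 h i)) j
  · intro h
    exact (measurable_pi_iff (X := fun _ : ι => κ → ℝ)).2 fun i =>
      measurable_pi_iff.2 fun j => h i j

variable [Fintype ι] [DecidableEq ι]

theorem Measurable.matrix_det {f : α → Matrix ι ι ℝ} (hf : Measurable f) :
    Measurable fun a => (f a).det := by
  have h := measurable_matrix_iff.1 hf
  simp only [Matrix.det_apply]
  refine Finset.measurable_sum _ fun σ _ => ?_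
  exact (Finset.measurable_prod _ fun i _ => h _ _).const_smul _

theorem Measurable.matrix_inv {f : α → Matrix ι ι ℝ} (hf : Measurable f) :
    Measurable fun a => (f a)⁻¹ := by
  refine measurable_matrix_iff.2 fun i j => ?_
  simp only [Matrix.inv_def, Ring.inverse_eq_inv', Matrix.smul_apply, Matrix.adjugate_apply,
    smul_eq_mul]
  refine hf.matrix_det.inv.mul (Measurable.matrix_det (measurable_matrix_iff.2 fun k l => ?_))
  by_cases hk : k = j
  · subst hk; simp
  · simpa [Matrix.updateRow_apply, hk] using measurable_matrix_iff.1 hf k l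

theorem Measurable.greenForm {f : α → Matrix ι ι ℝ} (hf : Measurable f) (X Y : ι → ℝ) :
    Measurable fun a => greenForm (f a) X Y := by
  have h := measurable_matrix_iff.1 hf.matrix_inv
  simp only [_root_.greenForm, dotProduct, Matrix.mulVec]
  exact Finset.measurable_sum _ fun i _ => (Finset.measurable_sum _ fun j _ =>
    (h i j).mul_const _).const_mul _

theorem measurable_betaMatrix (W : Matrix ι ι ℝ) : Measurable (betaMatrix W) := by
  refine measurable_matrix_iff.2 fun i j => ?_
  by_cases hij : i = j
  · subst hij
    simp only [betaMatrix, Matrix.sub_apply, Matrix.diagonal_apply_eq]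
    fun_prop
  · simp [betaMatrix, hij]

theorem measurableSet_posDef_betaMatrix (W : Matrix ι ι ℝ) :
    MeasurableSet {β : ι → ℝ | (betaMatrix W β).PosDef} := by
  have hcont : Continuous (betaMatrix W) := by unfold betaMatrix; fun_prop
  have h1 : {β : ι → ℝ | (betaMatrix W β).PosDef} =
      {β : ι → ℝ | (betaMatrix W β).PosSemidef} ∩ {β | (betaMatrix W β).det ≠ 0} := by
    ext β
    refine ⟨fun h => ⟨h.posSemidef, h.det_pos.ne'⟩, fun h => (h.1.posDef_iff_det_ne_zero).2 h.2⟩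
  have h2 : IsClosed {β : ι → ℝ | (betaMatrix W β).PosSemidef} := by
    simp only [Matrix.posSemidef_iff_dotProduct_mulVec, Matrix.IsHermitian, star_trivial]
    refine IsClosed.and ?_ ?_
    · exact isClosed_eq (by fun_prop) hcont
    · have h3 : {β : ι → ℝ | ∀ x : ι → ℝ, 0 ≤ x ⬝ᵥ (betaMatrix W β *ᵥ x)} =
          ⋂ x : ι → ℝ, {β : ι → ℝ | 0 ≤ x ⬝ᵥ (betaMatrix W β *ᵥ x)} := by
        ext β; simp
      rw [h3]
      refine isClosed_iInter fun x => isClosed_le continuous_const ?_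
      exact continuous_const.dotProduct (hcont.matrix_mulVec continuous_const)
  rw [h1]
  exact h2.measurableSet.inter
    ((measurableSet_singleton (0 : ℝ)).compl.preimage (measurable_betaMatrix W).matrix_det)

theorem measurable_betaDensity (W : Matrix ι ι ℝ) (η : ι → ℝ) :
    Measurable (betaDensity W η) := by
  have hM := measurable_betaMatrix W
  unfold betaDensity
  refine Measurable.ite ?_ ?_ measurable_const
  · have h1 : {β : ι → ℝ | ∀ i, 0 < β i} = ⋂ i, {β : ι → ℝ | 0 < β i} := by
      ext β; simp
    have h2 : MeasurableSet {β : ι → ℝ | ∀ i, 0 < β i} := by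
      rw [h1]
      exact MeasurableSet.iInter fun i => measurableSet_lt measurable_const (measurable_pi_apply i)
    exact h2.inter (measurableSet_posDef_betaMatrix W)
  · have h1 : Measurable fun β : ι → ℝ => (1 : ι → ℝ) ⬝ᵥ (betaMatrix W β *ᵥ 1) := by
      simp only [dotProduct, Matrix.mulVec]
      have h := measurable_matrix_iff.1 hM
      fun_prop
    have h2 : Measurable fun β : ι → ℝ => η ⬝ᵥ ((betaMatrix W β)⁻¹ *ᵥ η) := hM.greenForm η η
    have h3 := hM.matrix_det
    fun_prop

end Measurability

/-! ### Integrals against the law of the β-field, and its normalisation -/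

section Integrals

variable {ι κ : Type*} [Fintype ι] [DecidableEq ι] [Fintype κ] [DecidableEq κ]

theorem lintegral_sumElim {G : (ι ⊕ κ → ℝ) → ℝ≥0∞} (hG : Measurable G) :
    ∫⁻ x, G x = ∫⁻ β : ι → ℝ, ∫⁻ γ : κ → ℝ, G (Sum.elim β γ) := by
  have h := (volume_measurePreserving_sumPiEquivProdPi_symm (fun _ : ι ⊕ κ => ℝ))
  rw [← h.lintegral_comp_emb (MeasurableEquiv.measurableEmbedding _), Measure.volume_eq_prod]
  exact lintegral_prod _ (hG.comp h.measurable).aemeasurable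

theorem lintegral_betaLaw (W : Matrix ι ι ℝ) (η : ι → ℝ) (F : (ι → ℝ) → ℝ≥0∞) :
    ∫⁻ β, F β ∂betaLaw W η = ∫⁻ β, ENNReal.ofReal (betaDensity W η β) * F β := by
  rw [betaLaw, lintegral_withDensity_eq_lintegral_mul_non_measurable _
    (measurable_betaDensity W η).ennreal_ofReal (by simp)]
  rfl

theorem ae_betaLaw_posDef (W : Matrix ι ι ℝ) (η : ι → ℝ) :
    ∀ᵐ β ∂betaLaw W η, (betaMatrix W β).PosDef := by
  rw [betaLaw, ae_withDensity_iff (measurable_betaDensity W η).ennreal_ofReal]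
  refine Filter.Eventually.of_forall fun β h => ?_
  by_contra hP
  rw [betaDensity_of_not_posDef _ hP, ENNReal.ofReal_zero] at h
  exact h rfl

theorem lintegral_betaDensity_fromBlocks {W : Matrix ι ι ℝ} (hW : ∀ i, 0 ≤ W i i)
    (B : Matrix ι κ ℝ) {V : Matrix κ κ ℝ} (hV : ∀ k, 0 ≤ V k k) (ηU : ι → ℝ) (ηV : κ → ℝ)
    {F : (ι ⊕ κ → ℝ) → ℝ≥0∞} (hF : Measurable F) :
    ∫⁻ x, ENNReal.ofReal (betaDensity (Matrix.fromBlocks W B Bᵀ V) (Sum.elim ηU ηV) x) * F x =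
      ∫⁻ β, (∫⁻ γ, ENNReal.ofReal (betaDensity (schurWeights W B V β)
        (ηV + Bᵀ *ᵥ ((betaMatrix W β)⁻¹ *ᵥ ηU)) γ) * F (Sum.elim β γ))
        ∂betaLaw W (ηU + B *ᵥ 1) := by
  rw [lintegral_betaLaw]
  refine (lintegral_sumElim ((measurable_betaDensity _ _).ennreal_ofReal.mul hF)).trans ?_
  refine lintegral_congr fun β => ?_
  rw [← lintegral_const_mul' _ _ ENNReal.ofReal_ne_top]
  refine lintegral_congr fun γ => ?_
  rw [Pi.mul_apply, betaDensity_fromBlocks hW B hV, ENNReal.ofReal_mul (betaDensity_nonneg _ _ _),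
    mul_assoc]

theorem schurWeights_apply (W : Matrix ι ι ℝ) (B : Matrix ι κ ℝ) (V : Matrix κ κ ℝ)
    (β : ι → ℝ) (k l : κ) :
    schurWeights W B V β k l =
      V k l + greenForm (betaMatrix W β) (fun i => B i k) (fun i => B i l) := by
  rw [schurWeights, Matrix.add_apply, Matrix.mul_assoc]
  rfl

theorem lintegral_disc_tilt {κ : ℝ} (hκ : 0 ≤ κ) :
    ∫⁻ N, ENNReal.ofReal ((disc κ N + N) / disc κ N) ∂gauss = 1 := by
  have h : ∫⁻ N, ENNReal.ofReal ((disc κ N + N) / disc κ N) ∂gauss = ∫⁻ _, 1 ∂gauss := by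
    refine lintegral_gauss_congr_even ?_ measurable_const fun N hN => ?_
    · unfold disc; fun_prop
    · have h1 := abs_le_disc hκ N
      have h2 : 0 < disc κ N := (abs_pos.2 hN).trans_le h1
      have h3 := abs_le.1 h1
      rw [disc_neg, ← ENNReal.ofReal_add (div_nonneg (by linarith) h2.le)
        (div_nonneg (by linarith) h2.le), ← add_div,
        show disc κ N + N + (disc κ N + -N) = 2 * disc κ N by ring, mul_div_cancel_right₀ _ h2.ne']
      norm_num
  rw [h]; simp

theorem betaMatrix_off_diag (W : Matrix ι ι ℝ) (β : ι → ℝ) {i j : ι} (h : i ≠ j) :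
    betaMatrix W β i j = -W i j := by
  simp [betaMatrix, h]

theorem greenForm_betaMatrix_nonneg {W : Matrix ι ι ℝ} (hW : ∀ i j, 0 ≤ W i j) {β : ι → ℝ}
    (h : (betaMatrix W β).PosDef) {X Y : ι → ℝ} (hX : ∀ i, 0 ≤ X i) (hY : ∀ i, 0 ≤ Y i) :
    0 ≤ greenForm (betaMatrix W β) X Y := by
  refine greenForm_nonneg h (fun i j hij => ?_) hX hY
  rw [betaMatrix_off_diag W β hij]
  exact neg_nonpos.2 (hW i j)

theorem betaDensity_submatrix (W : Matrix ι ι ℝ) (η β : ι → ℝ) (e : κ ≃ ι) :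
    betaDensity (W.submatrix e e) (η ∘ e) (β ∘ e) = betaDensity W η β := by
  have h1 : betaMatrix (W.submatrix e e) (β ∘ e) = (betaMatrix W β).submatrix e e := by
    ext i j
    by_cases hij : i = j
    · subst hij; simp [betaMatrix]
    · simp [betaMatrix, hij]
  have h2 : ((betaMatrix W β).submatrix e e).PosDef ↔ (betaMatrix W β).PosDef := by
    constructor
    · intro h
      have := h.submatrix (e := e.symm) e.symm.injective
      simpa using this
    · intro h
      exact h.submatrix e.injective
  have h3 : (∀ i, 0 < (β ∘ e) i) ↔ ∀ i, 0 < β i := e.forall_congr_left.trans (by simp)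
  have h4 : (1 : κ → ℝ) = (1 : ι → ℝ) ∘ e := rfl
  have h5 : ∑ k, (η ∘ e) k = ∑ i, η i := e.sum_comp η
  unfold betaDensity
  rw [h1, h4, Matrix.inv_submatrix_equiv, Matrix.submatrix_mulVec_equiv,
    Matrix.submatrix_mulVec_equiv, Matrix.det_submatrix_equiv_self, h5, Fintype.card_congr e]
  simp only [Function.comp_assoc, Equiv.self_comp_symm, Function.comp_id,
    comp_equiv_dotProduct_comp_equiv]
  by_cases h : (∀ i, 0 < β i) ∧ (betaMatrix W β).PosDef
  · rw [if_pos h, if_pos ((and_congr h3 h2).2 h)]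
  · rw [if_neg h, if_neg (mt (and_congr h3 h2).1 h)]

/-- The total mass of the β-field is one: eliminate all vertices but the last, on which the
density is integrated by `lintegral_betaDensity_fin_one`. -/
theorem lintegral_betaDensity (n : ℕ) (W : Matrix (Fin n) (Fin n) ℝ) (hsymm : W.IsSymm)
    (hW : ∀ i j, 0 ≤ W i j) (η : Fin n → ℝ) (hη : ∀ i, 0 ≤ η i) :
    ∫⁻ β, ENNReal.ofReal (betaDensity W η β) = 1 := by
  induction n with
  | zero =>
    have h : ∀ β : Fin 0 → ℝ, betaDensity W η β = 1 := by
      intro β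
      have hP : (betaMatrix W β).PosDef := by
        refine Matrix.PosDef.of_dotProduct_mulVec_pos (Subsingleton.elim _ _) fun x hx => ?_
        exact absurd (Subsingleton.elim _ _) hx
      rw [betaDensity_of_posDef (fun i => i.elim0) _ hP]
      simp [betaEnergy, greenForm]
    simp only [h]
    simp [volume_pi]
  | succ n ih =>
    set e : Fin n ⊕ Fin 1 ≃ Fin (n + 1) := finSumFinEquiv
    set W' := W.submatrix e e with hW'
    set B := W'.toBlocks₁₂ with hB
    have hblocks : Matrix.fromBlocks W'.toBlocks₁₁ B Bᵀ W'.toBlocks₂₂ = W' := by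
      have : Bᵀ = W'.toBlocks₂₁ := by
        ext i j
        exact hsymm.apply _ _
      rw [this, Matrix.fromBlocks_toBlocks]
    have h1 : ∫⁻ β, ENNReal.ofReal (betaDensity W η β) =
        ∫⁻ x, ENNReal.ofReal (betaDensity W' (η ∘ e) x) := by
      have h := (volume_measurePreserving_piCongrLeft (fun _ : Fin (n + 1) => ℝ) e).symm
      rw [← h.lintegral_comp_emb (MeasurableEquiv.measurableEmbedding _)]
      refine lintegral_congr fun β => ?_
      rw [← betaDensity_submatrix W η β e]
      rfl
    have h2 := lintegral_betaDensity_fromBlocks (W := W'.toBlocks₁₁) (fun i => hW _ _) B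
      (V := W'.toBlocks₂₂) (fun i => hW _ _) ((η ∘ e) ∘ Sum.inl) ((η ∘ e) ∘ Sum.inr)
      (F := fun _ => 1) measurable_const
    rw [hblocks, Sum.elim_comp_inl_inr] at h2
    simp only [mul_one] at h2
    rw [h1, h2]
    have h3 : ∀ᵐ β ∂betaLaw W'.toBlocks₁₁ ((η ∘ e) ∘ Sum.inl + B *ᵥ 1),
        ∫⁻ γ, ENNReal.ofReal (betaDensity (schurWeights W'.toBlocks₁₁ B W'.toBlocks₂₂ β)
          ((η ∘ e) ∘ Sum.inr + Bᵀ *ᵥ ((betaMatrix W'.toBlocks₁₁ β)⁻¹ *ᵥ ((η ∘ e) ∘ Sum.inl))) γ)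
          = 1 := by
      filter_upwards [ae_betaLaw_posDef _ _] with β hβ
      have h4 := lintegral_betaDensity_fin_one
        (W := schurWeights W'.toBlocks₁₁ B W'.toBlocks₂₂ β)
        (schurWeights_diag_nonneg B (fun _ => hW _ _) hβ 0)
        (η := (η ∘ e) ∘ Sum.inr +
          Bᵀ *ᵥ ((betaMatrix W'.toBlocks₁₁ β)⁻¹ *ᵥ ((η ∘ e) ∘ Sum.inl)))
      have h5 : 0 ≤ ((η ∘ e) ∘ Sum.inr +
          Bᵀ *ᵥ ((betaMatrix W'.toBlocks₁₁ β)⁻¹ *ᵥ ((η ∘ e) ∘ Sum.inl))) 0 := by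
        refine add_nonneg (hη _) ?_
        exact greenForm_betaMatrix_nonneg (X := fun i => B i 0) (fun _ _ => hW _ _) hβ
          (fun _ => hW _ _) (fun _ => hη _)
      have h6 := h4 h5 (fun _ => 1)
      simp only [mul_one] at h6
      rw [h6, lintegral_disc_tilt h5]
    rw [lintegral_congr_ae h3, lintegral_betaLaw]
    simp only [mul_one]
    refine ih _ (by ext i j; exact hsymm.apply _ _) (fun _ _ => hW _ _) _ fun i => ?_
    refine add_nonneg (hη _) ?_
    have h7 : (B *ᵥ 1) i = B i 0 := by simp [Matrix.mulVec, dotProduct]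
    rw [h7]
    exact hW _ _

theorem isProbabilityMeasure_betaLaw {n : ℕ} {W : Matrix (Fin n) (Fin n) ℝ} (hsymm : W.IsSymm)
    (hW : ∀ i j, 0 ≤ W i j) {η : Fin n → ℝ} (hη : ∀ i, 0 ≤ η i) :
    IsProbabilityMeasure (betaLaw W η) := by
  constructor
  rw [betaLaw, withDensity_apply _ MeasurableSet.univ, Measure.restrict_univ,
    lintegral_betaDensity n W hsymm hW η hη]

end Integrals

/-! ### The Green form on two vertices -/

section PairGreen

variable {c δ : ℝ}

theorem betaMatrix_pair_posDef {V : Matrix (Fin 2) (Fin 2) ℝ} (hV : V.IsSymm) (hc : 0 ≤ V 0 1)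
    (hδ : |δ| ≤ 1) {m N : ℝ} (hm : m ≠ 0) (hN : 0 < pairDisc (V 0 1) δ m N + δ * N)
    {γ : Fin 2 → ℝ} (hγ : ∀ i, γ i = (pairDiag (V 0 1) δ m N i + V i i) / 2) :
    (betaMatrix V γ).PosDef := by
  rw [betaMatrix_fin_two_posDef_iff hV, hγ, hγ]
  have hdet := pairDiag_det hc hδ m N
  have hpos : 0 < (m * ((pairDisc (V 0 1) δ m N + δ * N) / 2)) ^ 2 := by positivity
  have ha : 0 ≤ pairDiag (V 0 1) δ m N 0 := by
    simp only [pairDiag, Matrix.cons_val_zero]; positivity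
  rw [show 2 * ((pairDiag (V 0 1) δ m N 0 + V 0 0) / 2) - V 0 0 = pairDiag (V 0 1) δ m N 0 by ring,
    show 2 * ((pairDiag (V 0 1) δ m N 1 + V 1 1) / 2) - V 1 1 = pairDiag (V 0 1) δ m N 1 by ring]
  refine ⟨ha.lt_of_ne fun h0 => ?_, by linarith⟩
  rw [← h0] at hdet
  nlinarith [sq_nonneg (V 0 1)]

/-- The Green form `x̂ᵀ S⁻¹ y`, multiplied by `p`, of `S = m² x̂ x̂ᵀ + z zᵀ`. -/
noncomputable def pairGreen (c δ m N p : ℝ) (y : Fin 2 → ℝ) : ℝ :=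
  p / m ^ 2 * (((pairDisc c δ m N - N) * y 0 + (pairDisc c δ m N + N) * y 1) /
    (pairDisc c δ m N + δ * N))

theorem greenForm_pair {V : Matrix (Fin 2) (Fin 2) ℝ} (hV : V.IsSymm) (hc : 0 ≤ V 0 1)
    (hδ : |δ| ≤ 1) {m N : ℝ} (hm : m ≠ 0) (hN : 0 < pairDisc (V 0 1) δ m N + δ * N)
    {γ : Fin 2 → ℝ} (hγ : ∀ i, γ i = (pairDiag (V 0 1) δ m N i + V i i) / 2) {p : ℝ}
    {x : Fin 2 → ℝ} (hx0 : x 0 = p * ((1 - δ) / 2)) (hx1 : x 1 = p * ((1 + δ) / 2))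
    (y : Fin 2 → ℝ) :
    greenForm (betaMatrix V γ) x y = pairGreen (V 0 1) δ m N p y := by
  have hP := betaMatrix_pair_posDef hV hc hδ hm hN hγ
  have h10 : V 1 0 = V 0 1 := hV.apply 0 1
  have hsq := pairDisc_sq hc hδ m N
  set c := V 0 1 with hcdef
  set D := pairDisc c δ m N with hD
  have hc' : c = (D ^ 2 - N ^ 2 - m ^ 2 * (1 - δ ^ 2)) / 4 := by rw [hsq]; ring
  obtain ⟨t, ht⟩ : ∃ t, t = D + δ * N := ⟨_, rfl⟩
  have hDt : D = t - δ * N := by rw [ht]; ring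
  have ht0 : 0 < t := ht ▸ hN
  have hv : betaMatrix V γ *ᵥ ![p / m ^ 2 * ((D - N) / (D + δ * N)),
      p / m ^ 2 * ((D + N) / (D + δ * N))] = x := by
    ext i
    fin_cases i
    · simp only [Matrix.mulVec, dotProduct, Fin.sum_univ_two, betaMatrix, Matrix.sub_apply,
        Fin.zero_eta, Matrix.diagonal_apply_eq, hγ, pairDiag, Matrix.cons_val_zero,
        Matrix.cons_val_one, ← hcdef, ← hD, hx0,
        Matrix.diagonal_apply_ne _ (show (0 : Fin 2) ≠ 1 by decide)]
      rw [hc', ← ht, hDt]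
      field_simp
      ring
    · simp only [Matrix.mulVec, dotProduct, Fin.sum_univ_two, betaMatrix, Matrix.sub_apply,
        Fin.mk_one, Matrix.diagonal_apply_eq, hγ, pairDiag, Matrix.cons_val_zero,
        Matrix.cons_val_one, ← hD, hx1, h10,
        Matrix.diagonal_apply_ne _ (show (1 : Fin 2) ≠ 0 by decide)]
      rw [hc', ← ht, hDt]
      field_simp
      ring
  rw [greenForm_comm hP.isSymm, greenForm_eq_dotProduct hP.isUnit_det hv, pairGreen, ← hD]
  simp only [dotProduct, Fin.sum_univ_two, Matrix.cons_val_zero, Matrix.cons_val_one]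
  ring

end PairGreen

/-! ### The fields on the whole vertex set in Gaussian coordinates -/

section Fields

variable {n : ℕ} (W : Matrix (Fin n) (Fin n) ℝ) (W₁ W₂ : Fin n → ℝ)

/-- The weights from the first `n` vertices to the last two. -/
def pairColumns : Matrix (Fin n) (Fin 2) ℝ := Matrix.of fun i => ![W₁ i, W₂ i]

/-- The weights from the first `n` vertices to the merged vertex. -/
def mergedColumn : Matrix (Fin n) (Fin 1) ℝ := Matrix.of fun i => ![W₁ i + W₂ i]

theorem twoPointWeights_eq (w : ℝ) : twoPointWeights W W₁ W₂ w =
    Matrix.fromBlocks W (pairColumns W₁ W₂) (pairColumns W₁ W₂)ᵀ !![0, w; w, 0] := by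
  have h : (pairColumns W₁ W₂)ᵀ = Matrix.of ![W₁, W₂] := by
    ext i j; fin_cases i <;> rfl
  rw [h]; rfl

theorem mergedWeights_eq : mergedWeights W W₁ W₂ =
    Matrix.fromBlocks W (mergedColumn W₁ W₂) (mergedColumn W₁ W₂)ᵀ !![0] := by
  have h : (mergedColumn W₁ W₂)ᵀ = Matrix.of ![W₁ + W₂] := by
    ext i j; fin_cases i; rfl
  rw [h]; rfl

theorem pairColumns_mulVec_one : pairColumns W₁ W₂ *ᵥ 1 = W₁ + W₂ := by
  ext i; simp [pairColumns, Matrix.mulVec, dotProduct, Fin.sum_univ_two]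

theorem mergedColumn_mulVec_one : mergedColumn W₁ W₂ *ᵥ 1 = W₁ + W₂ := by
  ext i; simp [mergedColumn, Matrix.mulVec, dotProduct]

/-- The off-diagonal weight between the last two vertices after eliminating the others. -/
noncomputable def crossWeight (w : ℝ) (β : Fin n → ℝ) : ℝ :=
  w + greenForm (betaMatrix W β) W₁ W₂

/-- The weights on the last two vertices after eliminating the others. -/
noncomputable def pairWeights (w : ℝ) (β : Fin n → ℝ) : Matrix (Fin 2) (Fin 2) ℝ :=
  schurWeights W (pairColumns W₁ W₂) !![0, w; w, 0] β

/-- The weight on the merged vertex after eliminating the others. -/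
noncomputable def mergedSchur (β : Fin n → ℝ) : Matrix (Fin 1) (Fin 1) ℝ :=
  schurWeights W (mergedColumn W₁ W₂) !![0] β

/-- The argument of the Green form of the last two vertices which block elimination produces
from a vector `X`. -/
noncomputable def reducedVec (X : Fin n ⊕ Fin 2 → ℝ) (β : Fin n → ℝ) : Fin 2 → ℝ :=
  X ∘ Sum.inr + (pairColumns W₁ W₂)ᵀ *ᵥ ((betaMatrix W β)⁻¹ *ᵥ (X ∘ Sum.inl))

/-- The direction of `x = reducedVec X β`, encoded by the `δ` with
`x = (x₀ + x₁) ((1 - δ)/2, (1 + δ)/2)`. If `x = 0`, division by zero gives `δ = 0`, which is as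
good as any other choice. -/
noncomputable def bias (X : Fin n ⊕ Fin 2 → ℝ) (β : Fin n → ℝ) : ℝ :=
  (reducedVec W W₁ W₂ X β 1 - reducedVec W W₁ W₂ X β 0) /
    (reducedVec W W₁ W₂ X β 0 + reducedVec W W₁ W₂ X β 1)

/-- The β-field with two last vertices, built from the field `β` on the first `n` vertices and the
Gaussian coordinates `(m, N)` of the Schur complement. -/
noncomputable def pairField (w : ℝ) (X : Fin n ⊕ Fin 2 → ℝ) (β : Fin n → ℝ) (m N : ℝ) :
    Fin n ⊕ Fin 2 → ℝ :=
  Sum.elim β fun i => (pairDiag (crossWeight W W₁ W₂ w β) (bias W W₁ W₂ X β) m N i +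
    pairWeights W W₁ W₂ w β i i) / 2

/-- The β-field with the last two vertices merged, with Schur complement `m²`. -/
noncomputable def mergedField (β : Fin n → ℝ) (m : ℝ) : Fin n ⊕ Fin 1 → ℝ :=
  Sum.elim β fun _ => (m ^ 2 + mergedSchur W W₁ W₂ β 0 0) / 2

variable {W W₁ W₂}

theorem pairWeights_zero_one (w : ℝ) (β : Fin n → ℝ) :
    pairWeights W W₁ W₂ w β 0 1 = crossWeight W W₁ W₂ w β := by
  rw [pairWeights, schurWeights_apply]; rfl

theorem schurWeights_isSymm {ι κ : Type*} [Fintype ι] [DecidableEq ι] [Fintype κ]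
    {W : Matrix ι ι ℝ} (B : Matrix ι κ ℝ) {V : Matrix κ κ ℝ} (hV : V.IsSymm) {β : ι → ℝ}
    (h : (betaMatrix W β).PosDef) : (schurWeights W B V β).IsSymm := by
  have hA := h.isSymm
  rw [Matrix.IsSymm] at hA
  rw [Matrix.IsSymm, schurWeights, Matrix.transpose_add, hV, Matrix.transpose_mul,
    Matrix.transpose_mul, Matrix.transpose_transpose, Matrix.transpose_nonsing_inv, hA,
    Matrix.mul_assoc]

theorem pairWeights_isSymm (w : ℝ) {β : Fin n → ℝ} (h : (betaMatrix W β).PosDef) :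
    (pairWeights W W₁ W₂ w β).IsSymm :=
  schurWeights_isSymm _ (by ext i j; fin_cases i <;> fin_cases j <;> rfl) h

theorem pairWeights_diag_nonneg (w : ℝ) {β : Fin n → ℝ} (h : (betaMatrix W β).PosDef) (i : Fin 2) :
    0 ≤ pairWeights W W₁ W₂ w β i i :=
  schurWeights_diag_nonneg _ (fun k => by fin_cases k <;> simp) h i

section Nonneg

variable (hW : ∀ i j, 0 ≤ W i j) (hW₁ : ∀ i, 0 ≤ W₁ i) (hW₂ : ∀ i, 0 ≤ W₂ i)
  {β : Fin n → ℝ} (hβ : (betaMatrix W β).PosDef)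

include hW hW₁ hW₂ hβ

theorem le_crossWeight (w : ℝ) : w ≤ crossWeight W W₁ W₂ w β :=
  le_add_of_nonneg_right (greenForm_betaMatrix_nonneg hW hβ hW₁ hW₂)

theorem reducedVec_nonneg {X : Fin n ⊕ Fin 2 → ℝ} (hX : ∀ k, 0 ≤ X k) (i : Fin 2) :
    0 ≤ reducedVec W W₁ W₂ X β i := by
  fin_cases i
  · exact add_nonneg (hX _) (greenForm_betaMatrix_nonneg hW hβ hW₁ fun _ => hX _)
  · exact add_nonneg (hX _) (greenForm_betaMatrix_nonneg hW hβ hW₂ fun _ => hX _)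

theorem abs_bias_le_one {X : Fin n ⊕ Fin 2 → ℝ} (hX : ∀ k, 0 ≤ X k) :
    |bias W W₁ W₂ X β| ≤ 1 := by
  have h0 := reducedVec_nonneg hW hW₁ hW₂ hβ hX 0
  have h1 := reducedVec_nonneg hW hW₁ hW₂ hβ hX 1
  rw [bias, abs_div, abs_of_nonneg (add_nonneg h0 h1)]
  refine div_le_one_of_le₀ ?_ (add_nonneg h0 h1)
  rw [abs_le]
  constructor <;> linarith

theorem reducedVec_eq_bias {X : Fin n ⊕ Fin 2 → ℝ} (hX : ∀ k, 0 ≤ X k) :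
    reducedVec W W₁ W₂ X β 0 = (reducedVec W W₁ W₂ X β 0 + reducedVec W W₁ W₂ X β 1) *
        ((1 - bias W W₁ W₂ X β) / 2) ∧
      reducedVec W W₁ W₂ X β 1 = (reducedVec W W₁ W₂ X β 0 + reducedVec W W₁ W₂ X β 1) *
        ((1 + bias W W₁ W₂ X β) / 2) := by
  have h0 := reducedVec_nonneg hW hW₁ hW₂ hβ hX 0
  have h1 := reducedVec_nonneg hW hW₁ hW₂ hβ hX 1
  unfold bias
  generalize reducedVec W W₁ W₂ X β 0 = a at *
  generalize reducedVec W W₁ W₂ X β 1 = b at *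
  rcases (add_nonneg h0 h1).lt_or_eq with h | h
  · constructor <;> field_simp <;> ring
  · have ha : a = 0 := by linarith
    have hb : b = 0 := by linarith
    simp [ha, hb]

end Nonneg

theorem posDef_pairField {w : ℝ} {X : Fin n ⊕ Fin 2 → ℝ} {β : Fin n → ℝ} {m N : ℝ}
    (hβ : (betaMatrix W β).PosDef) (hc : 0 ≤ crossWeight W W₁ W₂ w β)
    (hδ : |bias W W₁ W₂ X β| ≤ 1) (hm : m ≠ 0)
    (hN : 0 < pairDisc (crossWeight W W₁ W₂ w β) (bias W W₁ W₂ X β) m N +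
      bias W W₁ W₂ X β * N) :
    (betaMatrix (twoPointWeights W W₁ W₂ w) (pairField W W₁ W₂ w X β m N)).PosDef := by
  rw [← pairWeights_zero_one] at hc hN
  rw [twoPointWeights_eq, pairField, betaMatrix_fromBlocks, posDef_fromBlocks_iff hβ,
    ← betaMatrix_schurWeights]
  refine betaMatrix_pair_posDef (pairWeights_isSymm w hβ) hc hδ hm hN fun i => ?_
  rw [pairWeights_zero_one]

theorem greenForm_pairField {w : ℝ} {X : Fin n ⊕ Fin 2 → ℝ} {β : Fin n → ℝ} {m N : ℝ}
    (hW : ∀ i j, 0 ≤ W i j) (hW₁ : ∀ i, 0 ≤ W₁ i) (hW₂ : ∀ i, 0 ≤ W₂ i) (hX : ∀ k, 0 ≤ X k)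
    (hβ : (betaMatrix W β).PosDef) (hw : 0 ≤ w) (hm : m ≠ 0)
    (hN : 0 < pairDisc (crossWeight W W₁ W₂ w β) (bias W W₁ W₂ X β) m N +
      bias W W₁ W₂ X β * N) (Y : Fin n ⊕ Fin 2 → ℝ) :
    greenForm (betaMatrix (twoPointWeights W W₁ W₂ w) (pairField W W₁ W₂ w X β m N)) X Y =
      greenForm (betaMatrix W β) (X ∘ Sum.inl) (Y ∘ Sum.inl) +
      pairGreen (crossWeight W W₁ W₂ w β) (bias W W₁ W₂ X β) m N
        (reducedVec W W₁ W₂ X β 0 + reducedVec W W₁ W₂ X β 1) (reducedVec W W₁ W₂ Y β) := by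
  have hc := hw.trans (le_crossWeight hW hW₁ hW₂ hβ w)
  have hδ := abs_bias_le_one hW hW₁ hW₂ hβ hX
  have hP := posDef_pairField hβ hc hδ hm hN
  obtain ⟨h0, h1⟩ := reducedVec_eq_bias hW hW₁ hW₂ hβ hX
  rw [twoPointWeights_eq, pairField, betaMatrix_fromBlocks, posDef_fromBlocks_iff hβ] at hP
  rw [twoPointWeights_eq, pairField, betaMatrix_fromBlocks, greenForm_fromBlocks hβ _ hP]
  congr 1
  rw [← betaMatrix_schurWeights]
  rw [← pairWeights_zero_one] at hc hN ⊢
  exact greenForm_pair (pairWeights_isSymm w hβ) hc hδ hm hN (fun i => by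
    rw [pairWeights_zero_one]) h0 h1 _

theorem betaMatrix_mergedField (β : Fin n → ℝ) (m : ℝ) (γ : Fin 1 → ℝ)
    (hγ : γ 0 = (m ^ 2 + mergedSchur W W₁ W₂ β 0 0) / 2) :
    betaMatrix (mergedSchur W W₁ W₂ β) γ 0 0 = m ^ 2 := by
  simp [betaMatrix, hγ]; ring

theorem posDef_mergedField {β : Fin n → ℝ} {m : ℝ}
    (hβ : (betaMatrix W β).PosDef) (hm : m ≠ 0) :
    (betaMatrix (mergedWeights W W₁ W₂) (mergedField W W₁ W₂ β m)).PosDef := by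
  rw [mergedWeights_eq, mergedField, betaMatrix_fromBlocks, posDef_fromBlocks_iff hβ,
    ← betaMatrix_schurWeights, betaMatrix_fin_one_posDef_iff]
  change mergedSchur W W₁ W₂ β 0 0 < _
  have : 0 < m ^ 2 := by positivity
  linarith

theorem greenForm_add_columns (A : Matrix (Fin n) (Fin n) ℝ) (X : Fin n ⊕ Fin 2 → ℝ) :
    (mergeVec X ∘ Sum.inr + (mergedColumn W₁ W₂)ᵀ *ᵥ (A⁻¹ *ᵥ (mergeVec X ∘ Sum.inl))) 0 =
      (X (Sum.inr 0) + greenForm A W₁ (X ∘ Sum.inl)) +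
      (X (Sum.inr 1) + greenForm A W₂ (X ∘ Sum.inl)) := by
  have h : ((mergedColumn W₁ W₂)ᵀ *ᵥ (A⁻¹ *ᵥ (mergeVec X ∘ Sum.inl))) 0 =
      greenForm A (W₁ + W₂) (X ∘ Sum.inl) := rfl
  rw [Pi.add_apply, h, greenForm_add_left]
  simp [mergeVec]; ring

theorem greenForm_mergedField {β : Fin n → ℝ} {m : ℝ}
    (hβ : (betaMatrix W β).PosDef) (hm : m ≠ 0) (X Y : Fin n ⊕ Fin 2 → ℝ) :
    greenForm (betaMatrix (mergedWeights W W₁ W₂) (mergedField W W₁ W₂ β m))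
        (mergeVec X) (mergeVec Y) =
      greenForm (betaMatrix W β) (X ∘ Sum.inl) (Y ∘ Sum.inl) +
      (reducedVec W W₁ W₂ X β 0 + reducedVec W W₁ W₂ X β 1) *
        (reducedVec W W₁ W₂ Y β 0 + reducedVec W W₁ W₂ Y β 1) / m ^ 2 := by
  have hP := posDef_mergedField (W₁ := W₁) (W₂ := W₂) hβ hm
  rw [mergedWeights_eq, mergedField, betaMatrix_fromBlocks, posDef_fromBlocks_iff hβ] at hP
  rw [mergedWeights_eq, mergedField, betaMatrix_fromBlocks, greenForm_fromBlocks hβ _ hP]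
  congr 1
  rw [← betaMatrix_schurWeights, greenForm_fin_one, greenForm_add_columns, greenForm_add_columns]
  congr 1
  exact betaMatrix_mergedField β m _ rfl

theorem twoPointWeights_nonneg (hW : ∀ i j, 0 ≤ W i j) (hW₁ : ∀ i, 0 ≤ W₁ i)
    (hW₂ : ∀ i, 0 ≤ W₂ i) {w : ℝ} (hw0 : 0 ≤ w) (i j : Fin n ⊕ Fin 2) :
    0 ≤ twoPointWeights W W₁ W₂ w i j := by
  rcases i with i | i <;> rcases j with j | j
  · exact hW i j
  · fin_cases j
    exacts [hW₁ i, hW₂ i]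
  · fin_cases i
    exacts [hW₁ j, hW₂ j]
  · fin_cases i <;> fin_cases j <;> simp [twoPointWeights, hw0]

theorem mergedWeights_nonneg (hW : ∀ i j, 0 ≤ W i j) (hW₁ : ∀ i, 0 ≤ W₁ i)
    (hW₂ : ∀ i, 0 ≤ W₂ i) (i j : Fin n ⊕ Fin 1) : 0 ≤ mergedWeights W W₁ W₂ i j := by
  rcases i with i | i <;> rcases j with j | j
  · exact hW i j
  · fin_cases j
    exact add_nonneg (hW₁ i) (hW₂ i)
  · fin_cases i
    exact add_nonneg (hW₁ j) (hW₂ j)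
  · fin_cases i; fin_cases j; simp [mergedWeights]

/-- The law of the field with two last vertices, in Gaussian coordinates. The direction `bias`
is immaterial here: the formula holds for every choice of it. -/
theorem lintegral_betaLaw_twoPoint (hW : ∀ i j, 0 ≤ W i j) (hW₁ : ∀ i, 0 ≤ W₁ i)
    (hW₂ : ∀ i, 0 ≤ W₂ i) {X : Fin n ⊕ Fin 2 → ℝ} (hX : ∀ k, 0 ≤ X k) {w : ℝ} (hw : 0 ≤ w)
    {F : (Fin n ⊕ Fin 2 → ℝ) → ℝ≥0∞} (hF : Measurable F) :
    ∫⁻ x, F x ∂betaLaw (twoPointWeights W W₁ W₂ w) 0 =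
      ∫⁻ β, (∫⁻ m, ∫⁻ N, ENNReal.ofReal (pairWeight (crossWeight W W₁ W₂ w β)
        (bias W W₁ W₂ X β) m N) * F (pairField W W₁ W₂ w X β m N) ∂gauss ∂gauss)
        ∂betaLaw W (W₁ + W₂) := by
  have h0 : (0 : Fin n ⊕ Fin 2 → ℝ) = Sum.elim (0 : Fin n → ℝ) 0 := by
    ext k; rcases k with k | k <;> rfl
  rw [lintegral_betaLaw, twoPointWeights_eq, h0,
    lintegral_betaDensity_fromBlocks (fun i => hW i i) _ (fun k => by fin_cases k <;> simp) _ _ hF,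
    zero_add, pairColumns_mulVec_one]
  refine lintegral_congr_ae ?_
  filter_upwards [ae_betaLaw_posDef W (W₁ + W₂)] with β hβ
  have hc := hw.trans (le_crossWeight hW hW₁ hW₂ hβ w)
  rw [Matrix.mulVec_zero, Matrix.mulVec_zero, add_zero]
  rw [← pairWeights_zero_one] at hc
  have h := lintegral_betaDensity_fin_two (pairWeights_isSymm w hβ) (pairWeights_diag_nonneg w hβ)
    hc (abs_bias_le_one hW hW₁ hW₂ hβ hX) (F := fun γ => F (Sum.elim β γ))
    (hF.comp (measurable_pi_iff.2 fun k => by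
      rcases k with k | k
      exacts [measurable_const, measurable_pi_apply k]))
  rw [pairWeights_zero_one] at h
  exact h

theorem lintegral_betaLaw_merged (hW : ∀ i j, 0 ≤ W i j)
    {F : (Fin n ⊕ Fin 1 → ℝ) → ℝ≥0∞} (hF : Measurable F) :
    ∫⁻ x, F x ∂betaLaw (mergedWeights W W₁ W₂) 0 =
      ∫⁻ β, (∫⁻ m, F (mergedField W W₁ W₂ β m) ∂gauss) ∂betaLaw W (W₁ + W₂) := by
  have h0 : (0 : Fin n ⊕ Fin 1 → ℝ) = Sum.elim (0 : Fin n → ℝ) 0 := by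
    ext k; rcases k with k | k <;> rfl
  have hd : ∀ k : Fin 1, 0 ≤ (!![0] : Matrix (Fin 1) (Fin 1) ℝ) k k := fun k => by
    fin_cases k; simp
  rw [lintegral_betaLaw, mergedWeights_eq, h0,
    lintegral_betaDensity_fromBlocks (fun i => hW i i) _ hd _ _ hF,
    zero_add, mergedColumn_mulVec_one]
  refine lintegral_congr_ae ?_
  filter_upwards [ae_betaLaw_posDef W (W₁ + W₂)] with β hβ
  rw [Matrix.mulVec_zero, Matrix.mulVec_zero, add_zero]
  have h := lintegral_betaDensity_fin_one (W := mergedSchur W W₁ W₂ β) (η := 0)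
    (schurWeights_diag_nonneg _ hd hβ 0) le_rfl (fun γ => F (Sum.elim β γ))
  refine h.trans ?_
  have hFm : Measurable fun t : ℝ => F (Sum.elim β fun _ => t) :=
    hF.comp (measurable_pi_iff.2 fun k => by
      rcases k with k | k
      exacts [measurable_const, measurable_id])
  have habs : ∀ N, disc ((0 : Fin 1 → ℝ) 0) N = |N| := fun N => by
    simp [disc, Real.sqrt_sq_eq_abs]
  simp only [habs, mergedField]
  refine lintegral_gauss_congr_even ?_ ?_ fun N hN => ?_
  · refine Measurable.mul ?_ (hFm.comp ?_)
    · exact Measurable.ennreal_ofReal (by fun_prop)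
    · fun_prop
  · refine hFm.comp ?_
    fun_prop
  · -- Exactly one of `N` and `-N` carries the tilt `2`.
    rcases hN.lt_or_gt with h | h
    · have e1 : (-N + -N) / -N = 2 := by field_simp; norm_num
      have e2 : ((-N + -N) / 2) ^ 2 = (-N) ^ 2 := by ring
      rw [abs_neg, abs_of_neg h, neg_add_cancel, zero_div, e1, e2, ENNReal.ofReal_zero, zero_mul,
        zero_add, ENNReal.ofReal_ofNat, two_mul, neg_sq]
    · have e1 : (N + N) / N = 2 := by field_simp; norm_num
      have e2 : ((N + N) / 2) ^ 2 = N ^ 2 := by ring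
      rw [abs_neg, abs_of_pos h, add_neg_cancel, zero_div, e1, e2, ENNReal.ofReal_zero, zero_mul,
        add_zero, ENNReal.ofReal_ofNat, two_mul, neg_sq]

end Fields

/-! ### The joint tilt of a Gaussian coordinate and a sign -/

section Flip

/-- The sign encoded by a Boolean. -/
def boolSign (b : Bool) : ℝ := if b then 1 else -1

/-- The joint tilt of `N` and of a random sign, for weights `c ≤ c'`: the coordinate of the field
with weight `c` is `N`, that of the field with weight `c'` is `N` with the sign flipped with
conditional probability `(1 - D/D')/2`, where `D`, `D'` are the corresponding `pairDisc`. -/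
noncomputable def jointWeight (c c' δ m N : ℝ) (b : Bool) : ℝ :=
  pairWeight c δ m N * ((1 + boolSign b * (pairDisc c δ m N / pairDisc c' δ m N)) / 2)

variable {c c' δ : ℝ}

theorem pairDisc_mono (h : c ≤ c') (δ m N : ℝ) : pairDisc c δ m N ≤ pairDisc c' δ m N :=
  disc_mono (by unfold pairKappa; linarith) N

theorem pairDisc_pos (hc : 0 ≤ c) (hδ : |δ| ≤ 1) (m : ℝ) {N : ℝ} (hN : N ≠ 0) :
    0 < pairDisc c δ m N :=
  (abs_pos.2 hN).trans_le (abs_le_disc (pairKappa_nonneg hc hδ m) N)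

theorem pairDisc_add_mul_pos (hc : 0 < c) (hδ : |δ| ≤ 1) (m N : ℝ) :
    0 < pairDisc c δ m N + δ * N := by
  have h1 : |N| < pairDisc c δ m N := by
    refine abs_lt_of_sq_lt_sq ?_ (pairDisc_nonneg _ _ _ _)
    rw [pairDisc_sq hc.le hδ]
    have : δ ^ 2 ≤ 1 := by rwa [sq_le_one_iff_abs_le_one]
    have := mul_nonneg (sq_nonneg m) (show 0 ≤ 1 - δ ^ 2 by linarith)
    linarith
  have h2 : |δ * N| ≤ |N| := by
    rw [abs_mul]
    exact mul_le_of_le_one_left (abs_nonneg _) hδ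
  have h3 := neg_abs_le (δ * N)
  linarith

theorem jointWeight_nonneg (hc : 0 ≤ c) (hcc : c ≤ c') (hδ : |δ| ≤ 1) (m N : ℝ) (b : Bool) :
    0 ≤ jointWeight c c' δ m N b := by
  refine mul_nonneg (pairWeight_nonneg hc hδ m N) ?_
  have h1 : pairDisc c δ m N / pairDisc c' δ m N ≤ 1 :=
    div_le_one_of_le₀ (pairDisc_mono hcc δ m N) (pairDisc_nonneg _ _ _ _)
  have h2 : 0 ≤ pairDisc c δ m N / pairDisc c' δ m N :=
    div_nonneg (pairDisc_nonneg _ _ _ _) (pairDisc_nonneg _ _ _ _)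
  cases b <;> simp [boolSign] <;> linarith

theorem jointWeight_true_add_false (c c' δ m N : ℝ) :
    jointWeight c c' δ m N true + jointWeight c c' δ m N false = pairWeight c δ m N := by
  simp [jointWeight, boolSign]; ring

/-- The second marginal of the joint tilt. -/
theorem jointWeight_true_add_false_neg (hc : 0 ≤ c) (hcc : c ≤ c') (hδ : |δ| ≤ 1) (m : ℝ) {N : ℝ}
    (hN : N ≠ 0) :
    jointWeight c c' δ m N true + jointWeight c c' δ m (-N) false = pairWeight c' δ m N := by
  have h1 := pairDisc_pos hc hδ m hN
  have h2 := h1.trans_le (pairDisc_mono hcc δ m N)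
  simp only [jointWeight, boolSign, pairWeight, pairDisc_neg, if_true, Bool.false_eq_true,
    if_false]
  field_simp
  ring

theorem pairWeight_add_neg (hc : 0 ≤ c) (hδ : |δ| ≤ 1) (m : ℝ) {N : ℝ} (hN : N ≠ 0) :
    pairWeight c δ m N + pairWeight c δ m (-N) = 2 := by
  have h1 := pairDisc_pos hc hδ m hN
  simp only [pairWeight, pairDisc_neg]
  field_simp
  ring

theorem pairWeight_mul_pairGreen (hc : 0 < c) (hδ : |δ| ≤ 1) (m N p : ℝ) (y : Fin 2 → ℝ) :
    pairWeight c δ m N * pairGreen c δ m N p y =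
      p / m ^ 2 * (((pairDisc c δ m N - N) * y 0 + (pairDisc c δ m N + N) * y 1) /
        pairDisc c δ m N) := by
  have h := pairDisc_add_mul_pos hc hδ m N
  rw [pairWeight, pairGreen]
  generalize pairDisc c δ m N + δ * N = t at *
  field_simp

/-- The martingale property of the joint tilt: the Green form of the field with weight `c` has
the Green form of the field with weight `c'` as its conditional mean. -/
theorem jointWeight_pairGreen (hc : 0 < c) (hcc : c ≤ c') (hδ : |δ| ≤ 1) (m : ℝ) {N : ℝ}
    (hN : N ≠ 0) (α p : ℝ) (y : Fin 2 → ℝ) :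
    jointWeight c c' δ m N true * (α + pairGreen c δ m N p y) +
      jointWeight c c' δ m (-N) false * (α + pairGreen c δ m (-N) p y) =
    pairWeight c' δ m N * (α + pairGreen c' δ m N p y) := by
  have h1 := pairDisc_pos hc.le hδ m hN
  have h2 := h1.trans_le (pairDisc_mono hcc δ m N)
  have e1 : jointWeight c c' δ m N true * pairGreen c δ m N p y =
      pairWeight c δ m N * pairGreen c δ m N p y *
        ((1 + pairDisc c δ m N / pairDisc c' δ m N) / 2) := by
    simp only [jointWeight, boolSign, if_true]; ring
  have e2 : jointWeight c c' δ m (-N) false * pairGreen c δ m (-N) p y =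
      pairWeight c δ m (-N) * pairGreen c δ m (-N) p y *
        ((1 - pairDisc c δ m N / pairDisc c' δ m N) / 2) := by
    simp only [jointWeight, boolSign, Bool.false_eq_true, if_false, pairDisc_neg]; ring
  rw [mul_add, mul_add, mul_add, e1, e2, pairWeight_mul_pairGreen hc hδ,
    pairWeight_mul_pairGreen hc hδ, pairWeight_mul_pairGreen (hc.trans_le hcc) hδ,
    ← jointWeight_true_add_false_neg hc.le hcc hδ m hN, pairDisc_neg,
    add_mul (jointWeight _ _ _ _ _ _)]
  have e3 : ∀ a b u v w : ℝ, u + v = w → a + u + (b + v) = a + b + w := by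
    intro a b u v w h; linarith
  refine e3 _ _ _ _ _ ?_
  generalize p / m ^ 2 = r
  field_simp
  ring

/-- Averaging the tilted Green form over the sign of `N` gives the Green form of the merged
vertex. -/
theorem pairGreen_add_neg (hc : 0 < c) (hδ : |δ| ≤ 1) (m : ℝ) {N : ℝ} (hN : N ≠ 0)
    (α p : ℝ) (y : Fin 2 → ℝ) :
    pairWeight c δ m N * (α + pairGreen c δ m N p y) +
      pairWeight c δ m (-N) * (α + pairGreen c δ m (-N) p y) =
    2 * (α + p * (y 0 + y 1) / m ^ 2) := by
  have h1 := pairDisc_pos hc.le hδ m hN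
  rw [mul_add, mul_add, pairWeight_mul_pairGreen hc hδ, pairWeight_mul_pairGreen hc hδ,
    pairDisc_neg]
  have e := congrArg (· * α) (pairWeight_add_neg hc.le hδ m hN)
  simp only [add_mul] at e
  have e2 : p / m ^ 2 * (((pairDisc c δ m N - N) * y 0 + (pairDisc c δ m N + N) * y 1) /
        pairDisc c δ m N) +
      p / m ^ 2 * (((pairDisc c δ m N - -N) * y 0 + (pairDisc c δ m N + -N) * y 1) /
        pairDisc c δ m N) = 2 * (p * (y 0 + y 1) / m ^ 2) := by
    rw [mul_div_right_comm p]
    generalize p / m ^ 2 = r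
    field_simp
    ring
  linarith

/-- Along the direction `x` itself, the Green form depends on `m` only. -/
theorem pairGreen_self {m N p : ℝ} {x : Fin 2 → ℝ} (hN : 0 < pairDisc c δ m N + δ * N)
    (hx0 : x 0 = p * ((1 - δ) / 2)) (hx1 : x 1 = p * ((1 + δ) / 2)) :
    pairGreen c δ m N p x = p * p / m ^ 2 := by
  have h : (pairDisc c δ m N - N) * x 0 + (pairDisc c δ m N + N) * x 1 =
      p * (pairDisc c δ m N + δ * N) := by rw [hx0, hx1]; ring
  rw [pairGreen, h, mul_div_cancel_right₀ _ hN.ne']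
  ring

end Flip

/-! ### Conditional expectations of non-negative random variables -/

section CondExp

/-- A criterion for `E(Y | T) = z(T)`. -/
theorem condExpNonnegEq_of_lintegral {Ω α : Type*} [MeasurableSpace Ω] [MeasurableSpace α]
    {P : Measure Ω} [IsFiniteMeasure P] {Y : Ω → ℝ} {T : Ω → α} (hT : Measurable T) {z : α → ℝ}
    (hz : Measurable z) (hY0 : ∀ᵐ ω ∂P, 0 ≤ Y ω) (hZ0 : ∀ᵐ ω ∂P, 0 ≤ z (T ω))
    (h : ∀ G : α → ℝ≥0∞, Measurable G → ∫⁻ ω, G (T ω) * ENNReal.ofReal (Y ω) ∂P =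
      ∫⁻ ω, G (T ω) * ENNReal.ofReal (z (T ω)) ∂P) :
    CondExpNonnegEq P Y T (fun ω => z (T ω)) := by
  refine ⟨hY0, hZ0, ?_⟩
  have hle := hT.comap_le
  refine (ae_eq_condLExp hle P _ ?_ ?_).symm
  · exact (hz.comp (comap_measurable T)).ennreal_ofReal
  · rintro s ⟨B, hB, rfl⟩
    have hs : MeasurableSet (T ⁻¹' B) := hT hB
    have h1 := h (B.indicator 1) (measurable_one.indicator hB)
    rw [← lintegral_indicator hs, ← lintegral_indicator hs]
    have h2 : ∀ f : Ω → ℝ≥0∞, (fun ω => (T ⁻¹' B).indicator f ω) =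
        fun ω => B.indicator 1 (T ω) * f ω := by
      intro f
      funext ω
      by_cases hω : T ω ∈ B
      · rw [Set.indicator_of_mem hω, Set.indicator_of_mem (show ω ∈ T ⁻¹' B from hω)]; simp
      · rw [Set.indicator_of_notMem hω, Set.indicator_of_notMem (show ω ∉ T ⁻¹' B from hω)]; simp
    rw [h2, h2]
    exact h1.symm

end CondExp

/-! ### Connectedness and positivity of the effective weight -/

section Connected

variable {n : ℕ} {W : Matrix (Fin n) (Fin n) ℝ} {W₁ W₂ : Fin n → ℝ}

/-- If the last two vertices are connected, then they are joined by a positive weight after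
eliminating the others: otherwise the last vertex together with the support of `A⁻¹ W₂` would be
closed under connection, without containing the other vertex. -/
theorem crossWeight_pos (hW : ∀ i j, 0 ≤ W i j) (hW₁ : ∀ i, 0 ≤ W₁ i) (hW₂ : ∀ i, 0 ≤ W₂ i)
    {w : ℝ} (hw : 0 ≤ w) {x : Fin n ⊕ Fin 2 → ℝ}
    (hconn : MatrixConnected (betaMatrix (twoPointWeights W W₁ W₂ w) x) (Sum.inr 0) (Sum.inr 1))
    {β : Fin n → ℝ} (hβ : (betaMatrix W β).PosDef) : 0 < crossWeight W W₁ W₂ w β := by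
  refine (hw.trans (le_crossWeight hW hW₁ hW₂ hβ w)).lt_of_ne fun h0 => ?_
  have hoff : ∀ i j, i ≠ j → betaMatrix W β i j ≤ 0 := fun i j hij => by
    rw [betaMatrix_off_diag W β hij]; exact neg_nonpos.2 (hW i j)
  set v := (betaMatrix W β)⁻¹ *ᵥ W₂ with hv
  have hv0 : ∀ i, 0 ≤ v i := hβ.inv_mulVec_nonneg hoff hW₂
  have hAv : betaMatrix W β *ᵥ v = W₂ := hβ.mulVec_inv_mulVec W₂
  have hdot0 : 0 ≤ W₁ ⬝ᵥ v := Finset.sum_nonneg fun i _ => mul_nonneg (hW₁ i) (hv0 i)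
  have hsum : w + W₁ ⬝ᵥ v = 0 := h0.symm
  have hw0 : w = 0 := by linarith
  have hdot : W₁ ⬝ᵥ v = 0 := by linarith
  have hW₁v : ∀ i, W₁ i * v i = 0 := fun i =>
    (Finset.sum_eq_zero_iff_of_nonneg fun i _ => mul_nonneg (hW₁ i) (hv0 i)).1 hdot i
      (Finset.mem_univ i)
  have hpos : ∀ i, 0 < W₂ i → 0 < v i := by
    intro i hi
    refine (hv0 i).lt_of_ne fun hvi => ?_
    have h1 : W₂ i = ∑ j, betaMatrix W β i j * v j := (congrFun hAv i).symm
    have h2 : ∑ j, betaMatrix W β i j * v j ≤ 0 := Finset.sum_nonpos fun j _ => by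
      rcases eq_or_ne i j with rfl | hij
      · rw [← hvi, mul_zero]
      · exact mul_nonpos_of_nonpos_of_nonneg (hoff i j hij) (hv0 j)
    linarith
  have hpos' : ∀ i j, i ≠ j → 0 < W i j → 0 < v j → 0 < v i := by
    intro i j hij hWij hvj
    refine (hv0 i).lt_of_ne fun hvi => ?_
    have h1 : W₂ i = ∑ j, betaMatrix W β i j * v j := (congrFun hAv i).symm
    have h2 : ∑ j, betaMatrix W β i j * v j < ∑ _j : Fin n, (0 : ℝ) := by
      refine Finset.sum_lt_sum (fun k _ => ?_) ⟨j, Finset.mem_univ j, ?_⟩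
      · rcases eq_or_ne i k with rfl | hik
        · rw [← hvi, mul_zero]
        · exact mul_nonpos_of_nonpos_of_nonneg (hoff i k hik) (hv0 k)
      · rw [betaMatrix_off_diag W β hij]
        exact mul_neg_of_neg_of_pos (neg_neg_of_pos hWij) hvj
    rw [Finset.sum_const_zero] at h2
    have := hW₂ i
    linarith
  let S : Fin n ⊕ Fin 2 → Prop := Sum.elim (fun i => 0 < v i) (fun k => k = 1)
  have hclosed : ∀ k l, betaMatrix (twoPointWeights W W₁ W₂ w) x k l ≠ 0 → S l → S k := by
    intro k l hkl hl
    by_cases hne : k = l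
    · rwa [hne]
    rw [betaMatrix_off_diag _ _ hne, neg_ne_zero] at hkl
    rcases k with i | k <;> rcases l with j | l
    · have hij : i ≠ j := fun h => hne (by rw [h])
      exact hpos' i j hij ((hW i j).lt_of_ne (Ne.symm hkl)) hl
    · have hl1 : l = 1 := hl
      subst hl1
      exact hpos i ((hW₂ i).lt_of_ne (Ne.symm hkl))
    · fin_cases k
      · have hvj : 0 < v j := hl
        exact absurd (hW₁v j) (mul_ne_zero hkl hvj.ne')
      · rfl
    · have hl1 : l = 1 := hl
      subst hl1
      fin_cases k
      · exact absurd hw0 hkl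
      · rfl
  have hfinal : S (Sum.inr 0) := by
    have key : ∀ k, MatrixConnected (betaMatrix (twoPointWeights W W₁ W₂ w) x) k (Sum.inr 1) →
        S k := by
      intro k hk
      induction hk using Relation.ReflTransGen.head_induction_on with
      | refl => rfl
      | head h _ ih => exact hclosed _ _ h ih
    exact key _ hconn
  exact absurd hfinal (by simp [S])

end Connected

/-! ### Measurability of the fields in the coordinates -/

section CouplingMeasurability

variable {n : ℕ} (W : Matrix (Fin n) (Fin n) ℝ) (W₁ W₂ : Fin n → ℝ)

theorem measurable_crossWeight (w : ℝ) : Measurable (crossWeight W W₁ W₂ w) :=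
  ((measurable_betaMatrix W).greenForm W₁ W₂).const_add w

theorem measurable_bias (X : Fin n ⊕ Fin 2 → ℝ) : Measurable (bias W W₁ W₂ X) := by
  have h0 : Measurable fun β => reducedVec W W₁ W₂ X β 0 :=
    ((measurable_betaMatrix W).greenForm W₁ (X ∘ Sum.inl)).const_add _
  have h1 : Measurable fun β => reducedVec W W₁ W₂ X β 1 :=
    ((measurable_betaMatrix W).greenForm W₂ (X ∘ Sum.inl)).const_add _
  exact (h1.sub h0).div (h0.add h1)

theorem measurable_schurWeights_apply {ι κ : Type*} [Fintype ι] [DecidableEq ι]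
    (W : Matrix ι ι ℝ) (B : Matrix ι κ ℝ) (V : Matrix κ κ ℝ) [Fintype κ] [DecidableEq κ] (k l : κ) :
    Measurable fun β => schurWeights W B V β k l := by
  simp only [schurWeights_apply]
  exact ((measurable_betaMatrix W).greenForm _ _).const_add _

variable {α : Type*} [MeasurableSpace α]

theorem Measurable.pairDisc {c δ m N : α → ℝ} (hc : Measurable c) (hδ : Measurable δ)
    (hm : Measurable m) (hN : Measurable N) :
    Measurable fun a => pairDisc (c a) (δ a) (m a) (N a) :=
  continuous_pairDisc.measurable.comp (hc.prodMk (hδ.prodMk (hm.prodMk hN)))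

theorem Measurable.pairField {β : α → Fin n → ℝ} {m N : α → ℝ} (hβ : Measurable β)
    (hm : Measurable m) (hN : Measurable N) (w : ℝ) (X : Fin n ⊕ Fin 2 → ℝ) :
    Measurable fun a => pairField W W₁ W₂ w X (β a) (m a) (N a) := by
  have hc := (measurable_crossWeight W W₁ W₂ w).comp hβ
  have hδ := (measurable_bias W W₁ W₂ X).comp hβ
  have hD := hc.pairDisc hδ hm hN
  simp only [Function.comp_def] at hc hδ
  refine measurable_pi_iff.2 fun k => ?_
  rcases k with k | k
  · exact (measurable_pi_apply k).comp hβ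
  · have hV : Measurable fun a => pairWeights W W₁ W₂ w (β a) k k :=
      (measurable_schurWeights_apply _ _ _ k k).comp hβ
    refine Measurable.div_const (Measurable.add ?_ hV) _
    fin_cases k
    · exact ((hm.mul ((hδ.const_sub 1).div_const 2)).pow_const 2).add
        (((hD.add hN).div_const 2).pow_const 2)
    · exact ((hm.mul ((hδ.const_add 1).div_const 2)).pow_const 2).add
        (((hD.sub hN).div_const 2).pow_const 2)

theorem Measurable.mergedField {β : α → Fin n → ℝ} {m : α → ℝ} (hβ : Measurable β)
    (hm : Measurable m) : Measurable fun a => mergedField W W₁ W₂ (β a) (m a) := by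
  refine measurable_pi_iff.2 fun k => ?_
  rcases k with k | k
  · exact (measurable_pi_apply k).comp hβ
  · have hV : Measurable fun a => mergedSchur W W₁ W₂ (β a) 0 0 :=
      (measurable_schurWeights_apply _ _ _ _ _).comp hβ
    exact ((hm.pow_const 2).add hV).div_const 2

end CouplingMeasurability

/-! ### The coupling -/

section Coupling

/-- The probability space of the coupling: the field `β` on the first `n` vertices, the
coordinates `m` and `N`, and a sign. -/
abbrev CouplingSpace (n : ℕ) : Type := (Fin n → ℝ) × ℝ × ℝ × Bool

variable {n : ℕ} (W : Matrix (Fin n) (Fin n) ℝ) (W₁ W₂ : Fin n → ℝ) (wm wp : ℝ)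
  (X : Fin n ⊕ Fin 2 → ℝ)

/-- The density of the coupling: `jointWeight` for the weights between the last two vertices which
remain after eliminating the first `n`. -/
noncomputable def couplingDensity (ω : CouplingSpace n) : ℝ :=
  jointWeight (crossWeight W W₁ W₂ wm ω.1) (crossWeight W W₁ W₂ wp ω.1) (bias W W₁ W₂ X ω.1)
    ω.2.1 ω.2.2.1 ω.2.2.2

/-- The law of the coupling. The counting measure on the signs is normalised by the factor `1/2`
in `jointWeight`. -/
noncomputable def couplingMeasure : Measure (CouplingSpace n) :=
  ((betaLaw W (W₁ + W₂)).prod (gauss.prod (gauss.prod Measure.count))).withDensity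
    fun ω => ENNReal.ofReal (couplingDensity W W₁ W₂ wm wp X ω)

/-- The matrix `H⁻`, with the smaller weight between the last two vertices. -/
noncomputable def minusMatrix (ω : CouplingSpace n) : Matrix (Fin n ⊕ Fin 2) (Fin n ⊕ Fin 2) ℝ :=
  betaMatrix (twoPointWeights W W₁ W₂ wm) (pairField W W₁ W₂ wm X ω.1 ω.2.1 ω.2.2.1)

/-- The matrix `H⁺`, with the larger weight between the last two vertices; its Gaussian coordinate
is that of `H⁻` up to the sign. -/
noncomputable def plusMatrix (ω : CouplingSpace n) : Matrix (Fin n ⊕ Fin 2) (Fin n ⊕ Fin 2) ℝ :=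
  betaMatrix (twoPointWeights W W₁ W₂ wp)
    (pairField W W₁ W₂ wp X ω.1 ω.2.1 (boolSign ω.2.2.2 * ω.2.2.1))

/-- The matrix `H^∞`, with the last two vertices merged. It does not depend on `N`. -/
noncomputable def mergedMatrix (ω : CouplingSpace n) : Matrix (Fin n ⊕ Fin 1) (Fin n ⊕ Fin 1) ℝ :=
  betaMatrix (mergedWeights W W₁ W₂) (mergedField W W₁ W₂ ω.1 ω.2.1)

theorem measurable_boolSign : Measurable boolSign := measurable_of_countable _

theorem measurable_couplingDensity : Measurable (couplingDensity W W₁ W₂ wm wp X) := by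
  have hβ : Measurable fun ω : CouplingSpace n => ω.1 := measurable_fst
  have hm : Measurable fun ω : CouplingSpace n => ω.2.1 := by fun_prop
  have hN : Measurable fun ω : CouplingSpace n => ω.2.2.1 := by fun_prop
  have hb : Measurable fun ω : CouplingSpace n => boolSign ω.2.2.2 :=
    measurable_boolSign.comp (by fun_prop)
  have hδ := (measurable_bias W W₁ W₂ X).comp hβ
  have hD := ((measurable_crossWeight W W₁ W₂ wm).comp hβ).pairDisc hδ hm hN
  have hD' := ((measurable_crossWeight W W₁ W₂ wp).comp hβ).pairDisc hδ hm hN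
  exact ((hD.add (hδ.mul hN)).div hD).mul (((hb.mul (hD.div hD')).const_add 1).div_const 2)

theorem measurable_minusMatrix : Measurable (minusMatrix W W₁ W₂ wm X) :=
  (measurable_betaMatrix _).comp
    (Measurable.pairField W W₁ W₂ (by fun_prop) (by fun_prop) (by fun_prop) wm X)

theorem measurable_plusMatrix : Measurable (plusMatrix W W₁ W₂ wp X) := by
  have hb : Measurable fun ω : CouplingSpace n => boolSign ω.2.2.2 :=
    measurable_boolSign.comp (by fun_prop)
  exact (measurable_betaMatrix _).comp
    (Measurable.pairField W W₁ W₂ (by fun_prop) (by fun_prop) (by fun_prop) wp X)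

theorem measurable_mergedMatrix : Measurable (mergedMatrix W W₁ W₂ : CouplingSpace n → _) :=
  (measurable_betaMatrix _).comp (Measurable.mergedField W W₁ W₂ (by fun_prop) (by fun_prop))

variable {W W₁ W₂ wm wp X}

theorem plusMatrix_true (β : Fin n → ℝ) (m N : ℝ) :
    plusMatrix W W₁ W₂ wp X (β, m, N, true) =
      betaMatrix (twoPointWeights W W₁ W₂ wp) (pairField W W₁ W₂ wp X β m N) := by
  simp [plusMatrix, boolSign]

theorem plusMatrix_false (β : Fin n → ℝ) (m N : ℝ) :
    plusMatrix W W₁ W₂ wp X (β, m, N, false) = plusMatrix W W₁ W₂ wp X (β, m, -N, true) := by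
  simp [plusMatrix, boolSign]

theorem lintegral_couplingMeasure [IsProbabilityMeasure (betaLaw W (W₁ + W₂))]
    {F : CouplingSpace n → ℝ≥0∞} (hF : Measurable F) :
    ∫⁻ ω, F ω ∂couplingMeasure W W₁ W₂ wm wp X =
      ∫⁻ β, (∫⁻ m, ∫⁻ N,
        (ENNReal.ofReal (couplingDensity W W₁ W₂ wm wp X (β, m, N, true)) * F (β, m, N, true) +
        ENNReal.ofReal (couplingDensity W W₁ W₂ wm wp X (β, m, N, false)) * F (β, m, N, false))
        ∂gauss ∂gauss) ∂betaLaw W (W₁ + W₂) := by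
  have hd := (measurable_couplingDensity W W₁ W₂ wm wp X).ennreal_ofReal
  have hdF := hd.mul hF
  rw [couplingMeasure, lintegral_withDensity_eq_lintegral_mul _ hd hF,
    lintegral_prod _ hdF.aemeasurable]
  refine lintegral_congr fun β => ?_
  refine (lintegral_prod _ (hdF.comp measurable_prodMk_left).aemeasurable).trans ?_
  refine lintegral_congr fun m => ?_
  refine (lintegral_prod _
    ((hdF.comp measurable_prodMk_left).comp measurable_prodMk_left).aemeasurable).trans ?_
  refine lintegral_congr fun N => ?_
  rw [lintegral_count, tsum_fintype, Fintype.sum_bool]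
  rfl

section Hypotheses

variable (hW : ∀ i j, 0 ≤ W i j) (hW₁ : ∀ i, 0 ≤ W₁ i) (hW₂ : ∀ i, 0 ≤ W₂ i)
  (hwm : 0 ≤ wm) (hw : wm < wp) (hX : ∀ k, 0 ≤ X k) [IsProbabilityMeasure (betaLaw W (W₁ + W₂))]

include hW hW₁ hW₂ hwm hw

theorem crossWeight_plus_pos {β : Fin n → ℝ} (hβ : (betaMatrix W β).PosDef) :
    0 < crossWeight W W₁ W₂ wp β :=
  (hwm.trans_lt hw).trans_le (le_crossWeight hW hW₁ hW₂ hβ wp)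

include hX

theorem couplingDensity_nonneg {ω : CouplingSpace n} (hβ : (betaMatrix W ω.1).PosDef) :
    0 ≤ couplingDensity W W₁ W₂ wm wp X ω :=
  jointWeight_nonneg (hwm.trans (le_crossWeight hW hW₁ hW₂ hβ wm))
    (by unfold crossWeight; linarith) (abs_bias_le_one hW hW₁ hW₂ hβ hX) _ _ _

/-- To compare two expectations, it suffices to do so on the fibres over `β` and `m`, after
symmetrisation in `N`. -/
theorem lintegral_couplingMeasure_congr {F : CouplingSpace n → ℝ≥0∞} (hF : Measurable F)
    {K : (Fin n → ℝ) → ℝ → ℝ → ℝ≥0∞} (hK : ∀ β m, Measurable (K β m))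
    (h : ∀ β m N, (betaMatrix W β).PosDef → m ≠ 0 → N ≠ 0 →
      (ENNReal.ofReal (couplingDensity W W₁ W₂ wm wp X (β, m, N, true)) * F (β, m, N, true) +
        ENNReal.ofReal (couplingDensity W W₁ W₂ wm wp X (β, m, -N, false)) *
          F (β, m, -N, false)) +
      (ENNReal.ofReal (couplingDensity W W₁ W₂ wm wp X (β, m, -N, true)) * F (β, m, -N, true) +
        ENNReal.ofReal (couplingDensity W W₁ W₂ wm wp X (β, m, N, false)) *
          F (β, m, N, false)) = K β m N + K β m (-N)) :
    ∫⁻ ω, F ω ∂couplingMeasure W W₁ W₂ wm wp X =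
      ∫⁻ β, (∫⁻ m, ∫⁻ N, K β m N ∂gauss ∂gauss) ∂betaLaw W (W₁ + W₂) := by
  rw [lintegral_couplingMeasure hF]
  refine lintegral_congr_ae ?_
  filter_upwards [ae_betaLaw_posDef W (W₁ + W₂)] with β hβ
  refine lintegral_congr_ae ?_
  filter_upwards [ae_gauss_ne_zero] with m hm
  have hd := (measurable_couplingDensity W W₁ W₂ wm wp X).ennreal_ofReal.mul hF
  refine lintegral_gauss_congr_even ?_ (hK β m) fun N hN => ?_
  · exact Measurable.add (hd.comp (f := fun N : ℝ => (β, m, N, true)) (by fun_prop))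
      (hd.comp (f := fun N : ℝ => (β, m, N, false)) (by fun_prop))
  · rw [← h β m N hβ hm hN]
    abel

theorem ofReal_couplingDensity_add {β : Fin n → ℝ} (hβ : (betaMatrix W β).PosDef) (m : ℝ) {N : ℝ}
    (hN : N ≠ 0) :
    ENNReal.ofReal (couplingDensity W W₁ W₂ wm wp X (β, m, N, true)) +
      ENNReal.ofReal (couplingDensity W W₁ W₂ wm wp X (β, m, -N, false)) =
    ENNReal.ofReal (pairWeight (crossWeight W W₁ W₂ wp β) (bias W W₁ W₂ X β) m N) := by
  rw [← ENNReal.ofReal_add (couplingDensity_nonneg hW hW₁ hW₂ hwm hw hX hβ)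
    (couplingDensity_nonneg hW hW₁ hW₂ hwm hw hX hβ)]
  congr 1
  exact jointWeight_true_add_false_neg (hwm.trans (le_crossWeight hW hW₁ hW₂ hβ wm))
    (by unfold crossWeight; linarith) (abs_bias_le_one hW hW₁ hW₂ hβ hX) m hN

theorem ofReal_couplingDensity_neg_add {β : Fin n → ℝ} (hβ : (betaMatrix W β).PosDef) (m : ℝ)
    {N : ℝ} (hN : N ≠ 0) :
    ENNReal.ofReal (couplingDensity W W₁ W₂ wm wp X (β, m, -N, true)) +
      ENNReal.ofReal (couplingDensity W W₁ W₂ wm wp X (β, m, N, false)) =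
    ENNReal.ofReal (pairWeight (crossWeight W W₁ W₂ wp β) (bias W W₁ W₂ X β) m (-N)) := by
  have h := ofReal_couplingDensity_add hW hW₁ hW₂ hwm hw hX hβ m (neg_ne_zero.2 hN)
  rwa [neg_neg] at h

theorem ofReal_pairWeight_add {β : Fin n → ℝ} (hβ : (betaMatrix W β).PosDef) (m : ℝ) {N : ℝ}
    (hN : N ≠ 0) :
    ENNReal.ofReal (pairWeight (crossWeight W W₁ W₂ wp β) (bias W W₁ W₂ X β) m N) +
      ENNReal.ofReal (pairWeight (crossWeight W W₁ W₂ wp β) (bias W W₁ W₂ X β) m (-N)) = 2 := by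
  have hc := (hwm.trans hw.le).trans (le_crossWeight hW hW₁ hW₂ hβ wp)
  have hδ := abs_bias_le_one hW hW₁ hW₂ hβ hX
  rw [← ENNReal.ofReal_add (pairWeight_nonneg hc hδ _ _) (pairWeight_nonneg hc hδ _ _),
    pairWeight_add_neg hc hδ m hN, ENNReal.ofReal_ofNat]

theorem isProbabilityMeasure_couplingMeasure :
    IsProbabilityMeasure (couplingMeasure W W₁ W₂ wm wp X) := by
  constructor
  have h := lintegral_couplingMeasure_congr hW hW₁ hW₂ hwm hw hX (F := fun _ => 1)
    measurable_const (K := fun _ _ _ => 1) (fun _ _ => measurable_const) ?_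
  · rw [lintegral_one] at h
    rw [h]; simp
  · intro β m N hβ hm hN
    simp only [mul_one]
    rw [ofReal_couplingDensity_add hW hW₁ hW₂ hwm hw hX hβ m hN,
      ofReal_couplingDensity_neg_add hW hW₁ hW₂ hwm hw hX hβ m hN,
      ofReal_pairWeight_add hW hW₁ hW₂ hwm hw hX hβ m hN]
    exact one_add_one_eq_two.symm

theorem map_minusMatrix :
    (couplingMeasure W W₁ W₂ wm wp X).map (minusMatrix W W₁ W₂ wm X) =
      betaMatrixLaw (twoPointWeights W W₁ W₂ wm) 0 := by
  refine Measure.ext_of_lintegral _ fun F hF => ?_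
  have hFβ : Measurable fun x => F (betaMatrix (twoPointWeights W W₁ W₂ wm) x) :=
    hF.comp (measurable_betaMatrix _)
  rw [lintegral_map hF (measurable_minusMatrix W W₁ W₂ wm X), betaMatrixLaw,
    lintegral_map hF (measurable_betaMatrix _),
    lintegral_betaLaw_twoPoint hW hW₁ hW₂ hX hwm hFβ]
  refine (lintegral_couplingMeasure (hF.comp (measurable_minusMatrix W W₁ W₂ wm X))).trans ?_
  refine lintegral_congr_ae ?_
  filter_upwards [ae_betaLaw_posDef W (W₁ + W₂)] with β hβ
  refine lintegral_congr fun m => lintegral_congr fun N => ?_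
  have hnn := fun b => couplingDensity_nonneg hW hW₁ hW₂ hwm hw hX (ω := (β, m, N, b)) hβ
  rw [← jointWeight_true_add_false _ (crossWeight W W₁ W₂ wp β)]
  refine Eq.trans ?_ (congrArg (· * _) (ENNReal.ofReal_add (hnn true) (hnn false)).symm)
  rw [add_mul]
  rfl

theorem map_plusMatrix :
    (couplingMeasure W W₁ W₂ wm wp X).map (plusMatrix W W₁ W₂ wp X) =
      betaMatrixLaw (twoPointWeights W W₁ W₂ wp) 0 := by
  refine Measure.ext_of_lintegral _ fun F hF => ?_
  have hwp := hwm.trans hw.le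
  have hFβ : Measurable fun x => F (betaMatrix (twoPointWeights W W₁ W₂ wp) x) :=
    hF.comp (measurable_betaMatrix _)
  rw [lintegral_map hF (measurable_plusMatrix W W₁ W₂ wp X), betaMatrixLaw,
    lintegral_map hF (measurable_betaMatrix _),
    lintegral_betaLaw_twoPoint hW hW₁ hW₂ hX hwp hFβ]
  refine lintegral_couplingMeasure_congr hW hW₁ hW₂ hwm hw hX
    (hF.comp (measurable_plusMatrix W W₁ W₂ wp X)) (fun β m => ?_) fun β m N hβ hm hN => ?_
  · refine Measurable.mul (Measurable.ennreal_ofReal ?_)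
      (hFβ.comp (Measurable.pairField W W₁ W₂ measurable_const measurable_const measurable_id _ _))
    exact (measurable_pairWeight _ _).comp (f := fun N : ℝ => (m, N)) (by fun_prop)
  · simp only [Function.comp_apply, plusMatrix_false, neg_neg]
    rw [← add_mul, ← add_mul,
      ofReal_couplingDensity_add hW hW₁ hW₂ hwm hw hX hβ m hN,
      ofReal_couplingDensity_neg_add hW hW₁ hW₂ hwm hw hX hβ m hN, plusMatrix_true,
      plusMatrix_true]

theorem map_mergedMatrix :
    (couplingMeasure W W₁ W₂ wm wp X).map (mergedMatrix W W₁ W₂) =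
      betaMatrixLaw (mergedWeights W W₁ W₂) 0 := by
  refine Measure.ext_of_lintegral _ fun F hF => ?_
  have hFβ : Measurable fun x => F (betaMatrix (mergedWeights W W₁ W₂) x) :=
    hF.comp (measurable_betaMatrix _)
  rw [lintegral_map hF (measurable_mergedMatrix W W₁ W₂), betaMatrixLaw,
    lintegral_map hF (measurable_betaMatrix _), lintegral_betaLaw_merged hW hFβ]
  have h := lintegral_couplingMeasure_congr hW hW₁ hW₂ hwm hw hX
    (hF.comp (measurable_mergedMatrix W W₁ W₂))
    (K := fun β m _ => F (betaMatrix (mergedWeights W W₁ W₂) (mergedField W W₁ W₂ β m)))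
    (fun β m => measurable_const) fun β m N hβ hm hN => ?_
  · refine h.trans ?_
    refine lintegral_congr fun β => lintegral_congr fun m => ?_
    simp
  · simp only [Function.comp_apply, mergedMatrix]
    rw [← add_mul, ← add_mul, ← add_mul,
      ofReal_couplingDensity_add hW hW₁ hW₂ hwm hw hX hβ m hN,
      ofReal_couplingDensity_neg_add hW hW₁ hW₂ hwm hw hX hβ m hN,
      ofReal_pairWeight_add hW hW₁ hW₂ hwm hw hX hβ m hN, two_mul]

/-- The almost sure properties of a sample: all three chart formulas apply. -/
theorem ae_couplingMeasure :
    ∀ᵐ ω ∂couplingMeasure W W₁ W₂ wm wp X, (betaMatrix W ω.1).PosDef ∧ ω.2.1 ≠ 0 ∧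
      0 < pairDisc (crossWeight W W₁ W₂ wm ω.1) (bias W W₁ W₂ X ω.1) ω.2.1 ω.2.2.1 +
        bias W W₁ W₂ X ω.1 * ω.2.2.1 := by
  rw [couplingMeasure,
    ae_withDensity_iff (measurable_couplingDensity W W₁ W₂ wm wp X).ennreal_ofReal]
  have h1 := (Measure.quasiMeasurePreserving_fst (μ := betaLaw W (W₁ + W₂))
    (ν := gauss.prod (gauss.prod (Measure.count : Measure Bool)))).ae
    (ae_betaLaw_posDef W (W₁ + W₂))
  have h2 := (Measure.quasiMeasurePreserving_snd (μ := betaLaw W (W₁ + W₂))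
    (ν := gauss.prod (gauss.prod (Measure.count : Measure Bool)))).ae
    ((Measure.quasiMeasurePreserving_fst (μ := gauss)
      (ν := gauss.prod (Measure.count : Measure Bool))).ae ae_gauss_ne_zero)
  filter_upwards [h1, h2] with ω hβ hm hne
  refine ⟨hβ, hm, ?_⟩
  have hc := hwm.trans (le_crossWeight hW hW₁ hW₂ hβ wm)
  have hδ := abs_bias_le_one hW hW₁ hW₂ hβ hX
  by_contra hle
  refine hne (ENNReal.ofReal_eq_zero.2 (le_of_eq ?_))
  have h3 : pairWeight (crossWeight W W₁ W₂ wm ω.1) (bias W W₁ W₂ X ω.1) ω.2.1 ω.2.2.1 = 0 :=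
    le_antisymm (div_nonpos_of_nonpos_of_nonneg (not_lt.1 hle) (pairDisc_nonneg _ _ _ _))
      (pairWeight_nonneg hc hδ _ _)
  rw [couplingDensity, jointWeight, h3, zero_mul]

theorem greenForm_plusMatrix {ω : CouplingSpace n} (hβ : (betaMatrix W ω.1).PosDef)
    (hm : ω.2.1 ≠ 0) (Y : Fin n ⊕ Fin 2 → ℝ) :
    greenForm (plusMatrix W W₁ W₂ wp X ω) X Y =
      greenForm (betaMatrix W ω.1) (X ∘ Sum.inl) (Y ∘ Sum.inl) +
      pairGreen (crossWeight W W₁ W₂ wp ω.1) (bias W W₁ W₂ X ω.1) ω.2.1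
        (boolSign ω.2.2.2 * ω.2.2.1)
        (reducedVec W W₁ W₂ X ω.1 0 + reducedVec W W₁ W₂ X ω.1 1) (reducedVec W W₁ W₂ Y ω.1) :=
  greenForm_pairField hW hW₁ hW₂ hX hβ (hwm.trans hw.le) hm
    (pairDisc_add_mul_pos (crossWeight_plus_pos hW hW₁ hW₂ hwm hw hβ)
      (abs_bias_le_one hW hW₁ hW₂ hβ hX) _ _) Y

theorem ae_greenForm_self :
    ∀ᵐ ω ∂couplingMeasure W W₁ W₂ wm wp X,
      greenForm (minusMatrix W W₁ W₂ wm X ω) X X = greenForm (plusMatrix W W₁ W₂ wp X ω) X X ∧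
      greenForm (plusMatrix W W₁ W₂ wp X ω) X X =
        greenForm (mergedMatrix W W₁ W₂ ω) (mergeVec X) (mergeVec X) := by
  filter_upwards [ae_couplingMeasure hW hW₁ hW₂ hwm hw hX] with ω ⟨hβ, hm, hN⟩
  have hδ := abs_bias_le_one hW hW₁ hW₂ hβ hX
  obtain ⟨h0, h1⟩ := reducedVec_eq_bias hW hW₁ hW₂ hβ hX
  rw [greenForm_plusMatrix hW hW₁ hW₂ hwm hw hX hβ hm, mergedMatrix, greenForm_mergedField hβ hm,
    minusMatrix, greenForm_pairField hW hW₁ hW₂ hX hβ hwm hm hN, pairGreen_self hN h0 h1,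
    pairGreen_self (pairDisc_add_mul_pos (crossWeight_plus_pos hW hW₁ hW₂ hwm hw hβ) hδ _ _)
      h0 h1]
  exact ⟨rfl, rfl⟩

variable {Y : Fin n ⊕ Fin 2 → ℝ} (hY : ∀ k, 0 ≤ Y k)

include hY

theorem greenForm_plusMatrix_nonneg {ω : CouplingSpace n} (hβ : (betaMatrix W ω.1).PosDef)
    (hm : ω.2.1 ≠ 0) : 0 ≤ greenForm (plusMatrix W W₁ W₂ wp X ω) X Y := by
  have hc := crossWeight_plus_pos hW hW₁ hW₂ hwm hw hβ
  have hδ := abs_bias_le_one hW hW₁ hW₂ hβ hX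
  refine greenForm_betaMatrix_nonneg
    (twoPointWeights_nonneg hW hW₁ hW₂ (hwm.trans hw.le)) ?_ hX hY
  exact posDef_pairField hβ hc.le hδ hm (pairDisc_add_mul_pos hc hδ _ _)

theorem greenForm_minusMatrix_nonneg {ω : CouplingSpace n} (hβ : (betaMatrix W ω.1).PosDef)
    (hm : ω.2.1 ≠ 0)
    (hN : 0 < pairDisc (crossWeight W W₁ W₂ wm ω.1) (bias W W₁ W₂ X ω.1) ω.2.1 ω.2.2.1 +
        bias W W₁ W₂ X ω.1 * ω.2.2.1) : 0 ≤ greenForm (minusMatrix W W₁ W₂ wm X ω) X Y := by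
  have hc := hwm.trans (le_crossWeight hW hW₁ hW₂ hβ wm)
  have hδ := abs_bias_le_one hW hW₁ hW₂ hβ hX
  refine greenForm_betaMatrix_nonneg (twoPointWeights_nonneg hW hW₁ hW₂ hwm) ?_ hX hY
  exact posDef_pairField hβ hc hδ hm hN

theorem greenForm_mergedMatrix_nonneg {ω : CouplingSpace n} (hβ : (betaMatrix W ω.1).PosDef)
    (hm : ω.2.1 ≠ 0) : 0 ≤ greenForm (mergedMatrix W W₁ W₂ ω) (mergeVec X) (mergeVec Y) := by
  have hmerge : ∀ {Z : Fin n ⊕ Fin 2 → ℝ}, (∀ k, 0 ≤ Z k) → ∀ k, 0 ≤ mergeVec Z k := by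
    rintro Z hZ (k | k)
    · exact hZ _
    · exact add_nonneg (hZ _) (hZ _)
  exact greenForm_betaMatrix_nonneg (mergedWeights_nonneg hW hW₁ hW₂)
    (posDef_mergedField hβ hm) (hmerge hX) (hmerge hY)

/-- Averaging over the sign of `N` gives the merged Green form. -/
theorem ofReal_pairWeight_mul_greenForm_plusMatrix {β : Fin n → ℝ}
    (hβ : (betaMatrix W β).PosDef) {m N : ℝ} (hm : m ≠ 0) (hN : N ≠ 0) (b : Bool) :
    ENNReal.ofReal (pairWeight (crossWeight W W₁ W₂ wp β) (bias W W₁ W₂ X β) m N) *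
        ENNReal.ofReal (greenForm (plusMatrix W W₁ W₂ wp X (β, m, N, true)) X Y) +
      ENNReal.ofReal (pairWeight (crossWeight W W₁ W₂ wp β) (bias W W₁ W₂ X β) m (-N)) *
        ENNReal.ofReal (greenForm (plusMatrix W W₁ W₂ wp X (β, m, -N, true)) X Y) =
      2 * ENNReal.ofReal
        (greenForm (mergedMatrix W W₁ W₂ (β, m, N, b)) (mergeVec X) (mergeVec Y)) := by
  have hc := crossWeight_plus_pos hW hW₁ hW₂ hwm hw hβ
  have hδ := abs_bias_le_one hW hW₁ hW₂ hβ hX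
  have hw' := fun N => pairWeight_nonneg hc.le hδ m N
  have hg := fun N => greenForm_plusMatrix_nonneg hW hW₁ hW₂ hwm hw hX hY
    (ω := (β, m, N, true)) hβ hm
  rw [← ENNReal.ofReal_mul (hw' _), ← ENNReal.ofReal_mul (hw' _),
    ← ENNReal.ofReal_add (mul_nonneg (hw' _) (hg _)) (mul_nonneg (hw' _) (hg _)),
    ← ENNReal.ofReal_ofNat 2, ← ENNReal.ofReal_mul zero_le_two, mergedMatrix,
    greenForm_mergedField hβ hm, greenForm_plusMatrix hW hW₁ hW₂ hwm hw hX hβ hm,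
    greenForm_plusMatrix hW hW₁ hW₂ hwm hw hX hβ hm]
  simp only [boolSign, if_true, one_mul]
  rw [pairGreen_add_neg hc hδ m hN]

/-- Averaging over the sign flip gives the Green form of the field with the larger weight. -/
theorem ofReal_couplingDensity_mul_greenForm_minusMatrix {β : Fin n → ℝ}
    (hβ : (betaMatrix W β).PosDef) (hpos : 0 < crossWeight W W₁ W₂ wm β) {m N : ℝ} (hm : m ≠ 0)
    (hN : N ≠ 0) :
    ENNReal.ofReal (couplingDensity W W₁ W₂ wm wp X (β, m, N, true)) *
        ENNReal.ofReal (greenForm (minusMatrix W W₁ W₂ wm X (β, m, N, true)) X Y) +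
      ENNReal.ofReal (couplingDensity W W₁ W₂ wm wp X (β, m, -N, false)) *
        ENNReal.ofReal (greenForm (minusMatrix W W₁ W₂ wm X (β, m, -N, false)) X Y) =
      ENNReal.ofReal (pairWeight (crossWeight W W₁ W₂ wp β) (bias W W₁ W₂ X β) m N) *
        ENNReal.ofReal (greenForm (plusMatrix W W₁ W₂ wp X (β, m, N, true)) X Y) := by
  have hδ := abs_bias_le_one hW hW₁ hW₂ hβ hX
  have hcc : crossWeight W W₁ W₂ wm β ≤ crossWeight W W₁ W₂ wp β := by
    unfold crossWeight; linarith
  have hnn := fun N b => couplingDensity_nonneg hW hW₁ hW₂ hwm hw hX (ω := (β, m, N, b)) hβ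
  have hg := fun N b => greenForm_minusMatrix_nonneg hW hW₁ hW₂ hwm hw hX hY
    (ω := (β, m, N, b)) hβ hm (pairDisc_add_mul_pos hpos hδ _ _)
  have e : ∀ N b, greenForm (minusMatrix W W₁ W₂ wm X (β, m, N, b)) X Y = _ := fun N b =>
    greenForm_pairField hW hW₁ hW₂ hX hβ hwm hm (pairDisc_add_mul_pos hpos hδ m N) Y
  rw [← ENNReal.ofReal_mul (hnn _ _), ← ENNReal.ofReal_mul (hnn _ _),
    ← ENNReal.ofReal_add (mul_nonneg (hnn _ _) (hg _ _)) (mul_nonneg (hnn _ _) (hg _ _)),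
    ← ENNReal.ofReal_mul (pairWeight_nonneg (hpos.le.trans hcc) hδ _ _), e, e,
    greenForm_plusMatrix hW hW₁ hW₂ hwm hw hX hβ hm]
  simp only [boolSign, if_true, one_mul]
  congr 1
  exact jointWeight_pairGreen hpos hcc hδ m hN _ _ _

/-- Averaging the Green form with the larger weight against a function of the merged field. -/
theorem lintegral_mul_greenForm_plusMatrix
    {G : Matrix (Fin n ⊕ Fin 1) (Fin n ⊕ Fin 1) ℝ → ℝ≥0∞} (hG : Measurable G) :
    ∫⁻ ω, G (mergedMatrix W W₁ W₂ ω) *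
        ENNReal.ofReal (greenForm (plusMatrix W W₁ W₂ wp X ω) X Y)
          ∂couplingMeasure W W₁ W₂ wm wp X =
      ∫⁻ ω, G (mergedMatrix W W₁ W₂ ω) *
        ENNReal.ofReal (greenForm (mergedMatrix W W₁ W₂ ω) (mergeVec X) (mergeVec Y))
          ∂couplingMeasure W W₁ W₂ wm wp X := by
  have hT : Measurable fun ω => G (mergedMatrix W W₁ W₂ ω) :=
    hG.comp (measurable_mergedMatrix W W₁ W₂)
  have hL : Measurable fun ω => ENNReal.ofReal (greenForm (plusMatrix W W₁ W₂ wp X ω) X Y) :=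
    ((measurable_plusMatrix W W₁ W₂ wp X).greenForm X Y).ennreal_ofReal
  have hR : Measurable fun ω =>
      ENNReal.ofReal (greenForm (mergedMatrix W W₁ W₂ ω) (mergeVec X) (mergeVec Y)) :=
    ((measurable_mergedMatrix W W₁ W₂).greenForm _ _).ennreal_ofReal
  have hTL : Measurable fun ω => G (mergedMatrix W W₁ W₂ ω) *
      ENNReal.ofReal (greenForm (plusMatrix W W₁ W₂ wp X ω) X Y) := hT.mul hL
  have hTR : Measurable fun ω => G (mergedMatrix W W₁ W₂ ω) *
      ENNReal.ofReal (greenForm (mergedMatrix W W₁ W₂ ω) (mergeVec X) (mergeVec Y)) := hT.mul hR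
  -- Both sides are the integral of a function which does not depend on `N`.
  let K : (Fin n → ℝ) → ℝ → ℝ → ℝ≥0∞ := fun β m _ =>
    G (mergedMatrix W W₁ W₂ (β, m, 0, true)) * ENNReal.ofReal
      (greenForm (mergedMatrix W W₁ W₂ (β, m, 0, true)) (mergeVec X) (mergeVec Y))
  have hK : ∀ β m, Measurable (K β m) := fun β m => measurable_const
  rw [lintegral_couplingMeasure_congr hW hW₁ hW₂ hwm hw hX hTL hK,
    lintegral_couplingMeasure_congr hW hW₁ hW₂ hwm hw hX hTR hK]
  · intro β m N hβ hm hN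
    simp only [mergedMatrix, K]
    rw [← add_mul, ← add_mul, ← add_mul,
      ofReal_couplingDensity_add hW hW₁ hW₂ hwm hw hX hβ m hN,
      ofReal_couplingDensity_neg_add hW hW₁ hW₂ hwm hw hX hβ m hN,
      ofReal_pairWeight_add hW hW₁ hW₂ hwm hw hX hβ m hN, two_mul]
  · intro β m N hβ hm hN
    have hmean := ofReal_pairWeight_mul_greenForm_plusMatrix hW hW₁ hW₂ hwm hw hX hY hβ hm hN true
    simp only [plusMatrix_false, neg_neg, mergedMatrix, K] at hmean ⊢
    rw [← ofReal_couplingDensity_add hW hW₁ hW₂ hwm hw hX hβ m hN,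
      ← ofReal_couplingDensity_neg_add hW hW₁ hW₂ hwm hw hX hβ m hN] at hmean
    rw [← add_mul, ← add_mul, mul_left_comm, mul_left_comm _ (G _), ← mul_add, hmean, two_mul,
      mul_add]

/-- Averaging the Green form with the smaller weight against a function of the field with the
larger weight. -/
theorem lintegral_mul_greenForm_minusMatrix
    (hpos : ∀ β, (betaMatrix W β).PosDef → 0 < crossWeight W W₁ W₂ wm β)
    {G : Matrix (Fin n ⊕ Fin 2) (Fin n ⊕ Fin 2) ℝ → ℝ≥0∞} (hG : Measurable G) :
    ∫⁻ ω, G (plusMatrix W W₁ W₂ wp X ω) *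
        ENNReal.ofReal (greenForm (minusMatrix W W₁ W₂ wm X ω) X Y)
          ∂couplingMeasure W W₁ W₂ wm wp X =
      ∫⁻ ω, G (plusMatrix W W₁ W₂ wp X ω) *
        ENNReal.ofReal (greenForm (plusMatrix W W₁ W₂ wp X ω) X Y)
          ∂couplingMeasure W W₁ W₂ wm wp X := by
  have hT : Measurable fun ω => G (plusMatrix W W₁ W₂ wp X ω) :=
    hG.comp (measurable_plusMatrix W W₁ W₂ wp X)
  have hL : Measurable fun ω => ENNReal.ofReal (greenForm (minusMatrix W W₁ W₂ wm X ω) X Y) :=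
    ((measurable_minusMatrix W W₁ W₂ wm X).greenForm X Y).ennreal_ofReal
  have hR : Measurable fun ω => ENNReal.ofReal (greenForm (plusMatrix W W₁ W₂ wp X ω) X Y) :=
    ((measurable_plusMatrix W W₁ W₂ wp X).greenForm X Y).ennreal_ofReal
  have hTL : Measurable fun ω => G (plusMatrix W W₁ W₂ wp X ω) *
      ENNReal.ofReal (greenForm (minusMatrix W W₁ W₂ wm X ω) X Y) := hT.mul hL
  have hTR : Measurable fun ω => G (plusMatrix W W₁ W₂ wp X ω) *
      ENNReal.ofReal (greenForm (plusMatrix W W₁ W₂ wp X ω) X Y) := hT.mul hR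
  let K : (Fin n → ℝ) → ℝ → ℝ → ℝ≥0∞ := fun β m N =>
    G (plusMatrix W W₁ W₂ wp X (β, m, N, true)) *
      (ENNReal.ofReal (pairWeight (crossWeight W W₁ W₂ wp β) (bias W W₁ W₂ X β) m N) *
        ENNReal.ofReal (greenForm (plusMatrix W W₁ W₂ wp X (β, m, N, true)) X Y))
  have hK : ∀ β m, Measurable (K β m) := by
    intro β m
    have hN : Measurable fun N : ℝ => ((β, m, N, true) : CouplingSpace n) := by fun_prop
    have hq : Measurable fun N : ℝ => (m, N) := by fun_prop
    have hw : Measurable fun N : ℝ =>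
        pairWeight (crossWeight W W₁ W₂ wp β) (bias W W₁ W₂ X β) m N :=
      (measurable_pairWeight _ _).comp hq
    exact (hT.comp hN).mul (hw.ennreal_ofReal.mul (hR.comp hN))
  rw [lintegral_couplingMeasure_congr hW hW₁ hW₂ hwm hw hX hTL hK,
    lintegral_couplingMeasure_congr hW hW₁ hW₂ hwm hw hX hTR hK]
  · intro β m N hβ hm hN
    simp only [plusMatrix_false, neg_neg, K]
    rw [← add_mul, ← add_mul, ofReal_couplingDensity_add hW hW₁ hW₂ hwm hw hX hβ m hN,
      ofReal_couplingDensity_neg_add hW hW₁ hW₂ hwm hw hX hβ m hN, mul_left_comm,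
      mul_left_comm _ (G _)]
  · intro β m N hβ hm hN
    have h1 := ofReal_couplingDensity_mul_greenForm_minusMatrix hW hW₁ hW₂ hwm hw hX hY hβ
      (hpos β hβ) hm hN
    have h2 := ofReal_couplingDensity_mul_greenForm_minusMatrix hW hW₁ hW₂ hwm hw hX hY hβ
      (hpos β hβ) hm (neg_ne_zero.2 hN)
    rw [neg_neg] at h2
    simp only [plusMatrix_false, neg_neg, K]
    rw [← h1, ← h2, mul_add, mul_add]
    simp only [mul_left_comm]

theorem condExp_plusMatrix :
    CondExpNonnegEq (couplingMeasure W W₁ W₂ wm wp X)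
      (fun ω => greenForm (plusMatrix W W₁ W₂ wp X ω) X Y) (mergedMatrix W W₁ W₂)
      (fun ω => greenForm (mergedMatrix W W₁ W₂ ω) (mergeVec X) (mergeVec Y)) := by
  have := isProbabilityMeasure_couplingMeasure hW hW₁ hW₂ hwm hw hX
  have hae := ae_couplingMeasure hW hW₁ hW₂ hwm hw hX
  refine condExpNonnegEq_of_lintegral (z := fun H => greenForm H (mergeVec X) (mergeVec Y))
    (measurable_mergedMatrix W W₁ W₂) (measurable_id.greenForm _ _) ?_ ?_ fun G hG =>
      lintegral_mul_greenForm_plusMatrix hW hW₁ hW₂ hwm hw hX hY hG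
  · filter_upwards [hae] with ω ⟨hβ, hm, _⟩
    exact greenForm_plusMatrix_nonneg hW hW₁ hW₂ hwm hw hX hY hβ hm
  · filter_upwards [hae] with ω ⟨hβ, hm, _⟩
    exact greenForm_mergedMatrix_nonneg hW hW₁ hW₂ hwm hw hX hY hβ hm

theorem condExp_minusMatrix
    (hpos : ∀ β, (betaMatrix W β).PosDef → 0 < crossWeight W W₁ W₂ wm β) :
    CondExpNonnegEq (couplingMeasure W W₁ W₂ wm wp X)
      (fun ω => greenForm (minusMatrix W W₁ W₂ wm X ω) X Y) (plusMatrix W W₁ W₂ wp X)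
      (fun ω => greenForm (plusMatrix W W₁ W₂ wp X ω) X Y) := by
  have := isProbabilityMeasure_couplingMeasure hW hW₁ hW₂ hwm hw hX
  have hae := ae_couplingMeasure hW hW₁ hW₂ hwm hw hX
  refine condExpNonnegEq_of_lintegral (z := fun H => greenForm H X Y)
    (measurable_plusMatrix W W₁ W₂ wp X) (measurable_id.greenForm _ _) ?_ ?_ fun G hG =>
      lintegral_mul_greenForm_minusMatrix hW hW₁ hW₂ hwm hw hX hY hpos hG
  · filter_upwards [hae] with ω ⟨hβ, hm, hN⟩
    exact greenForm_minusMatrix_nonneg hW hW₁ hW₂ hwm hw hX hY hβ hm hN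
  · filter_upwards [hae] with ω ⟨hβ, hm, _⟩
    exact greenForm_plusMatrix_nonneg hW hW₁ hW₂ hwm hw hX hY hβ hm

end Hypotheses

end Coupling

theorem theorem5 (n : ℕ) (W : Matrix (Fin n) (Fin n) ℝ) (hWsymm : W.IsSymm)
    (hWdiag : ∀ i, W i i = 0) (hWoff : ∀ i j, i ≠ j → 0 ≤ W i j)
    (W₁ W₂ : Fin n → ℝ) (hW₁ : ∀ i, 0 ≤ W₁ i) (hW₂ : ∀ i, 0 ≤ W₂ i)
    (wm wp : ℝ) (hwm : 0 ≤ wm) (hw : wm < wp)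
    (X₁ : Fin n ⊕ Fin 2 → ℝ) (hX₁ : ∀ k, 0 ≤ X₁ k) :
    ∃ (Ω : Type) (_ : MeasurableSpace Ω) (P : Measure Ω) (_ : IsProbabilityMeasure P)
      (Hm Hp : Ω → Matrix (Fin n ⊕ Fin 2) (Fin n ⊕ Fin 2) ℝ)
      (Hi : Ω → Matrix (Fin n ⊕ Fin 1) (Fin n ⊕ Fin 1) ℝ),
      Measurable Hm ∧ Measurable Hp ∧ Measurable Hi ∧
      P.map Hm = betaMatrixLaw (twoPointWeights W W₁ W₂ wm) 0 ∧
      P.map Hp = betaMatrixLaw (twoPointWeights W W₁ W₂ wp) 0 ∧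
      P.map Hi = betaMatrixLaw (mergedWeights W W₁ W₂) 0 ∧
      (∀ᵐ ω ∂P, greenForm (Hm ω) X₁ X₁ = greenForm (Hp ω) X₁ X₁ ∧
        greenForm (Hp ω) X₁ X₁ = greenForm (Hi ω) (mergeVec X₁) (mergeVec X₁)) ∧
      (∀ ω (i : Fin n), Hm ω (Sum.inl i) (Sum.inl i) = Hp ω (Sum.inl i) (Sum.inl i) ∧
        Hp ω (Sum.inl i) (Sum.inl i) = Hi ω (Sum.inl i) (Sum.inl i)) ∧
      ∀ X₂ : Fin n ⊕ Fin 2 → ℝ, (∀ k, 0 ≤ X₂ k) →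
        CondExpNonnegEq P (fun ω => greenForm (Hp ω) X₁ X₂) Hi
          (fun ω => greenForm (Hi ω) (mergeVec X₁) (mergeVec X₂)) ∧
        ((∀ᵐ ω ∂P, MatrixConnected (Hm ω) (Sum.inr 0) (Sum.inr 1)) →
          CondExpNonnegEq P (fun ω => greenForm (Hm ω) X₁ X₂) Hp
            (fun ω => greenForm (Hp ω) X₁ X₂)) := by
  have hW : ∀ i j, 0 ≤ W i j := fun i j => by
    rcases eq_or_ne i j with rfl | h
    · exact (hWdiag i).ge
    · exact hWoff i j h
  have hν : IsProbabilityMeasure (betaLaw W (W₁ + W₂)) :=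
    isProbabilityMeasure_betaLaw hWsymm hW fun i => add_nonneg (hW₁ i) (hW₂ i)
  have hP := isProbabilityMeasure_couplingMeasure hW hW₁ hW₂ hwm hw hX₁
  refine ⟨CouplingSpace n, inferInstance, couplingMeasure W W₁ W₂ wm wp X₁, hP,
    minusMatrix W W₁ W₂ wm X₁, plusMatrix W W₁ W₂ wp X₁, mergedMatrix W W₁ W₂,
    measurable_minusMatrix W W₁ W₂ wm X₁, measurable_plusMatrix W W₁ W₂ wp X₁,
    measurable_mergedMatrix W W₁ W₂, map_minusMatrix hW hW₁ hW₂ hwm hw hX₁,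
    map_plusMatrix hW hW₁ hW₂ hwm hw hX₁, map_mergedMatrix hW hW₁ hW₂ hwm hw hX₁,
    ae_greenForm_self hW hW₁ hW₂ hwm hw hX₁, fun ω i => ?_, fun X₂ hX₂ => ⟨?_, fun hconn => ?_⟩⟩
  · simp [minusMatrix, plusMatrix, mergedMatrix, betaMatrix, twoPointWeights, mergedWeights,
      pairField, mergedField]
  · exact condExp_plusMatrix hW hW₁ hW₂ hwm hw hX₁ hX₂
  · -- Connection does not depend on the diagonal, so one sample settles it for all.
    obtain ⟨ω, hω⟩ := hconn.exists
    exact condExp_minusMatrix hW hW₁ hW₂ hwm hw hX₁ hX₂ fun β hβ =>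
      crossWeight_pos hW hW₁ hW₂ hwm hω hβ
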